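/- Let $\sigma,s_0,s_1\in\mathbb R$ with $s_1\le s_0+1$, and let $a:\mathbb R\to\mathbb R$ be smooth and convex with $a''(\xi)\approx\langle\xi\rangle^{\sigma}$ and $|\partial_\xi^j a''(\xi)|\lesssim_j\langle\xi\rangle^{\sigma-j}$ for $j\ge1$, where $\langle\xi\rangle=(1+\xi^2)^{1/2}$. With $D=-i\partial_x$, let $\langle D\rangle^s$ and $A'(D)$ be the Fourier multipliers with symbols $\langle\xi\rangle^s$ and $a'(\xi)$. For $t>0$ let $L=x-tA'(D)$, acting on tempered distributions on $\mathbb R$, and $$\|u\|_X^2=\|u\|_{H^{s_0}}^2+\|Lu\|_{H^{s_1}}^2,\qquad \|v\|_{H^s}=\|\langle D\rangle^s v\|_{L^2}.$$ **a)** Let $\delta=s_0+s_1+\sigma>0$. For every $\varepsilon>0$ there is a constant $C=C(\sigma,s_0,s_1,a,\varepsilon)$ such that for all $t>0$ and all $u\in X$ $$\|\langle D\rangle^{\frac\delta2-\varepsilon}u\|_{L^\infty}\le C\,t^{-1/2}\,\|u\|_X .$$ **b)** (No condition on $\delta$.) Let $K\ge1$ and $\kappa>1$. There is a constant $C=C(\sigma,s_0,s_1,a,K,\kappa)$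 such that the following holds for all $t>0$. Let $\lambda\ge1$ and let $I=[\alpha,\beta]\subset\mathbb R$, $\alpha<\beta$, be a frequency interval at frequency $\lambda$, that is, $\lambda\le K|I|$ and $K^{-1}\lambda\le\langle\xi\rangle\le K\lambda$ on $I$ (for instance $\lambda=(1+\mu)^m$ and $I=\pm[\lambda,(1+\mu)\lambda]$, with $K$ depending on $\mu$). Let $\tilde J=t\,a'(I)$ be the corresponding spatial interval, let $x_\lambda\in\tilde J$, and let $\chi_\lambda:\mathbb R\to[0,1]$ be any function that equals $1$ on $\kappa\tilde J$, the dilate of $\tilde J$ by the factor $\kappa$ about its centre (for instance, if $\kappa<2$, a smooth cutoff supported in $2\tilde J$). Then every $u_\lambda\in X$ whose Fourier transform is supported in $I$ is a continuous function in $L^2$, and $$\|(1-\chi_\lambda)(x-x_\lambda)u_\lambda\|_{L^2}\le C\lambda^{-s_1}\|u_\lambda\|_X,$$ $$|(1-\chi_\lambda(x))\,u_\lambda(x)|\le C\,\frac{\lambda^{-s_1+\frac12}}{|x-x_\lambda|}\,\|u_\lambda\|_X\qquad\text{for all }x\ne x_\lambda .$$ -/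

import Mathlib

open MeasureTheory FourierTransform SchwartzMap
open scoped ENNReal ContDiff

noncomputable section

/-- The Japanese bracket `⟨ξ⟩ = (1 + ξ²)^{1/2}`. -/
def japanese (ξ : ℝ) : ℝ := Real.sqrt (1 + ξ ^ 2)

/-- The dispersion relation `a`: real, smooth, convex, with `a'' ≈ ⟨ξ⟩^σ` and the symbol type bounds
`|∂^j a''| ≲ ⟨ξ⟩^{σ - j}`. -/
structure IsDispersionSymbol (σ : ℝ) (a : ℝ → ℝ) : Prop where
  smooth : ContDiff ℝ ∞ a
  convexity : ∃ c C : ℝ, 0 < c ∧ ∀ ξ : ℝ,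
    c * japanese ξ ^ σ ≤ iteratedDeriv 2 a ξ ∧ iteratedDeriv 2 a ξ ≤ C * japanese ξ ^ σ
  symbol_bounds : ∀ j : ℕ, 1 ≤ j → ∃ C : ℝ, ∀ ξ : ℝ,
    |iteratedDeriv (j + 2) a ξ| ≤ C * japanese ξ ^ (σ - j)

/-- The Fourier multiplier `m(D)`, `D = -i ∂_x`, on tempered distributions on the line. Mathlib's
Fourier transform has the kernel `e^{-2π i x η}`, so that `D` corresponds to `ξ = 2π η`. -/
def multiplier (m : ℝ → ℝ) (u : 𝓢'(ℝ, ℂ)) : 𝓢'(ℝ, ℂ) :=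
  TemperedDistribution.fourierMultiplierCLM ℂ (fun η : ℝ ↦ ((m (2 * Real.pi * η) : ℝ) : ℂ)) u

/-- `⟨D⟩^s`. -/
def japaneseD (s : ℝ) (u : 𝓢'(ℝ, ℂ)) : 𝓢'(ℝ, ℂ) :=
  multiplier (fun ξ ↦ japanese ξ ^ s) u

/-- The vector field `L u = x u - t A'(D) u`, where `A'(D)` has the symbol `a'`. -/
def vectorField (a : ℝ → ℝ) (t : ℝ) (u : 𝓢'(ℝ, ℂ)) : 𝓢'(ℝ, ℂ) :=
  TemperedDistribution.smulLeftCLM ℂ (fun x : ℝ ↦ (x : ℂ)) u - (t : ℂ) • multiplier (deriv a) u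

/-- The `L^p` norm of a tempered distribution: the norm of the `L^p` function that represents it
(which is unique), and `∞` if there is none. -/
def distLpNorm (p : ℝ≥0∞) [Fact (1 ≤ p)] (u : 𝓢'(ℝ, ℂ)) : ℝ≥0∞ :=
  ⨅ (f : Lp ℂ p (volume : Measure ℝ)) (_ : (f : 𝓢'(ℝ, ℂ)) = u), ‖f‖ₑ

/-- The norm of the space `X` at time `t`: `‖u‖_X² = ‖u‖_{H^{s₀}}² + ‖L u‖_{H^{s₁}}²`
(with value `∞` outside `X`). -/
def normX (a : ℝ → ℝ) (s₀ s₁ t : ℝ) (u : 𝓢'(ℝ, ℂ)) : ℝ≥0∞ :=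
  (distLpNorm 2 (japaneseD s₀ u) ^ 2
    + distLpNorm 2 (japaneseD s₁ (vectorField a t u)) ^ 2) ^ (1 / 2 : ℝ)

/-- `I = [α, β]` is a frequency interval at dyadic frequency `lam ≥ 1`, with comparability constant
`K`: `⟨ξ⟩ ≈ lam` on `I` and `|I| ≈ lam`. For instance `lam = (1 + μ)^m` and `I` one of
`± [lam, (1 + μ) lam]`, or `lam = 1` and `I` a subinterval of `[-1, 1]` of length `μ`, with a `K`
that depends only on `μ`. -/
structure IsFrequencyInterval (K lam α β : ℝ) : Prop where
  one_le : 1 ≤ lam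
  lt : α < β
  length_ge : lam ≤ K * (β - α)
  bracket : ∀ ξ ∈ Set.Icc α β, lam ≤ K * japanese ξ ∧ japanese ξ ≤ K * lam

/-- The Fourier transform of `u` is supported in the frequency interval `[α, β]`. -/
def IsLocalizedIn (u : 𝓢'(ℝ, ℂ)) (α β : ℝ) : Prop :=
  Distribution.dsupport (𝓕 u : 𝓢'(ℝ, ℂ)) ⊆ {η : ℝ | 2 * Real.pi * η ∈ Set.Icc α β}

/-- The spatial interval `J̃ = t a'(I)` of the velocities that correspond to `I = [α, β]`. -/
def spatialInterval (a : ℝ → ℝ) (t α β : ℝ) : Set ℝ :=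
  (fun ξ ↦ t * deriv a ξ) '' Set.Icc α β

/-- The dilate `κ J̃` of `J̃ = [t a'(α), t a'(β)]` about its centre. -/
def dilatedSpatialInterval (a : ℝ → ℝ) (κ t α β : ℝ) : Set ℝ :=
  Set.Icc (t * (deriv a α + deriv a β) / 2 - κ * (t * (deriv a β - deriv a α) / 2))
    (t * (deriv a α + deriv a β) / 2 + κ * (t * (deriv a β - deriv a α) / 2))

/-- `χ : ℝ → [0, 1]` selects `J̃`: it equals `1` on the dilate `κ J̃`. -/
structure IsSpatialCutoff (a : ℝ → ℝ) (κ t α β : ℝ) (χ : ℝ → ℝ) : Prop where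
  mem_Icc : ∀ x, χ x ∈ Set.Icc (0 : ℝ) 1
  eq_one : ∀ x ∈ dilatedSpatialInterval a κ t α β, χ x = 1

end

/-! The free flow is removed first. Put v = e^{ita} û. On the Fourier side x acts as a derivative,
and the factor e^{ita} absorbs the term with a', so v' is a constant multiple of e^{ita} times the
transform of Lu. Hence the norm of X controls ⟨ξ⟩^{s₀} v and ⟨ξ⟩^{s₁} v' in L², and t survives only
in the phase of u(x) = ∫ e^{i(xξ - ta(ξ))} v (`IsDispersionSymbol.exists_isProfile`).

Part a). Let N bound the norm of u. At frequencies comparable to λ one has ‖v‖ ≲ A = λ^{-s₀} N and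
‖v'‖ ≲ B = λ^{-s₁} N in L². The condition s₁ ≤ s₀ + 1 says A ≲ λB, so the block is long enough for
the interpolation bound |v| ≲ √(AB) (`IsPrimitive.norm_le`). The phase has second derivative at
least Λ ≈ tλ^σ, and a van der Corput estimate for amplitudes with only an L² derivative bounds the
block by √(AB/Λ) (`IsPrimitive.norm_integral_oscillatory_le`). This is t^{-1/2} λ^{-(s₀+s₁+σ)/2} N;
after ⟨D⟩^{δ/2-ε} a factor λ^{-ε} remains, and the dyadic sum is geometric.

Part b). Let c and r be the centre and the radius of J̃, and write ta' = c + rp, so that |p| ≤ 1 on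
I. Let f_k be the inverse transform of e^{-ita} p^k v; thus f_0 = u. Integration by parts gives (x -
c) f_k = r f_{k+1} plus a term from (p^k v)' (`IsLocalProfile.sub_mul_truncatedInv`). As v vanishes
at the ends of I, Poincaré's inequality bounds this term in L² by a multiple of (k+1) λ^{-s₁} N. Off
κJ̃ one has r ≤ κ⁻¹|x - c|, so the sizes Z_k of (x - c) f_k satisfy Z_k ≤ (k+1) D + κ⁻¹ Z_{k+1}, and
iteration yields Z_0 ≤ D/(1 - κ⁻¹)² (`le_of_le_add_mul_succ`). The same argument runs in L² off κJ̃
and at a single point; the latter costs |I|^{1/2} by Cauchy-Schwarz. No kernel bounds and no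
regularity of the cutoff enter. -/

/-! ### The Japanese bracket and its powers. -/

theorem one_le_japanese (ξ : ℝ) : 1 ≤ japanese ξ :=
  Real.one_le_sqrt.2 (by nlinarith [sq_nonneg ξ])

theorem japanese_pos (ξ : ℝ) : 0 < japanese ξ := zero_lt_one.trans_le (one_le_japanese ξ)

theorem abs_le_japanese (ξ : ℝ) : |ξ| ≤ japanese ξ :=
  Real.abs_le_sqrt (by linarith)

theorem japanese_le_one_add_abs (ξ : ℝ) : japanese ξ ≤ 1 + |ξ| :=
  Real.sqrt_le_iff.2 ⟨by positivity, by nlinarith [sq_abs ξ, abs_nonneg ξ]⟩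

theorem japanese_rpow_pos (ξ s : ℝ) : 0 < japanese ξ ^ s := Real.rpow_pos_of_pos (japanese_pos ξ) s

theorem japanese_rpow_eq (ξ s : ℝ) : japanese ξ ^ s = (1 + ‖ξ‖ ^ 2) ^ (s / 2) := by
  rw [japanese, Real.sqrt_eq_rpow, ← Real.rpow_mul (by positivity), Real.norm_eq_abs, sq_abs]
  congr 1
  ring

theorem hasTemperateGrowth_japanese_rpow (s : ℝ) :
    (fun ξ : ℝ ↦ japanese ξ ^ s).HasTemperateGrowth := by
  simp_rw [japanese_rpow_eq]
  fun_prop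

theorem hasTemperateGrowth_scaled {m : ℝ → ℝ} (hm : m.HasTemperateGrowth) :
    (fun η : ℝ ↦ ((m (2 * Real.pi * η) : ℝ) : ℂ)).HasTemperateGrowth := by
  have h : (fun η : ℝ ↦ 2 * Real.pi * η).HasTemperateGrowth := by fun_prop
  exact Function.Complex.hasTemperateGrowth_ofReal.comp (hm.comp h)

theorem hasDerivAt_japanese (ξ : ℝ) : HasDerivAt japanese (ξ / japanese ξ) ξ := by
  have h : HasDerivAt (fun ξ : ℝ ↦ 1 + ξ ^ 2) (2 * ξ) ξ := by
    simpa using (hasDerivAt_pow 2 ξ).const_add 1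
  convert! h.sqrt (by positivity) using 1
  rw [japanese, mul_div_mul_left _ _ two_ne_zero]

theorem hasDerivAt_japanese_rpow (s ξ : ℝ) :
    HasDerivAt (fun ξ ↦ japanese ξ ^ s) (s * japanese ξ ^ (s - 1) * (ξ / japanese ξ)) ξ := by
  convert! (hasDerivAt_japanese ξ).rpow_const (p := s) (Or.inl (japanese_pos ξ).ne') using 1
  ring

theorem rpow_le_of_comparable {c x lam : ℝ} (hc : 1 ≤ c) (hx : 0 < x) (hlam : 0 < lam)
    (h₁ : lam ≤ c * x) (h₂ : x ≤ c * lam) (s : ℝ) : x ^ s ≤ c ^ |s| * lam ^ s := by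
  rcases le_total 0 s with hs | hs
  · rw [abs_of_nonneg hs, ← Real.mul_rpow (by positivity) hlam.le]
    exact Real.rpow_le_rpow hx.le h₂ hs
  · rw [abs_of_nonpos hs]
    calc x ^ s ≤ (c⁻¹ * lam) ^ s := by
          refine Real.rpow_le_rpow_of_nonpos (by positivity) ?_ hs
          rwa [inv_mul_le_iff₀ (by positivity)]
      _ = c ^ (-s) * lam ^ s := by
          rw [Real.mul_rpow (by positivity) hlam.le, Real.inv_rpow (by positivity),
            Real.rpow_neg (by positivity)]

theorem le_rpow_of_comparable {c x lam : ℝ} (hc : 1 ≤ c) (hx : 0 < x) (hlam : 0 < lam)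
    (h₁ : lam ≤ c * x) (h₂ : x ≤ c * lam) (s : ℝ) : (c ^ |s|)⁻¹ * lam ^ s ≤ x ^ s := by
  rw [inv_mul_le_iff₀ (by positivity)]
  exact rpow_le_of_comparable hc hlam hx h₂ h₁ s

/-! ### Monotonicity and temperate growth of the velocity a'. -/

namespace IsDispersionSymbol

variable {σ : ℝ} {a : ℝ → ℝ}

theorem iteratedDeriv_two_eq (a : ℝ → ℝ) : iteratedDeriv 2 a = deriv (deriv a) := by
  rw [iteratedDeriv_succ, iteratedDeriv_one]

theorem contDiff_deriv (ha : IsDispersionSymbol σ a) : ContDiff ℝ ∞ (deriv a) :=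
  (contDiff_infty_iff_deriv.1 ha.smooth).2

theorem hasDerivAt (ha : IsDispersionSymbol σ a) (ξ : ℝ) : HasDerivAt a (deriv a ξ) ξ :=
  (ha.smooth.differentiable (by simp) ξ).hasDerivAt

theorem hasDerivAt_deriv (ha : IsDispersionSymbol σ a) (ξ : ℝ) :
    HasDerivAt (deriv a) (deriv (deriv a) ξ) ξ :=
  (ha.contDiff_deriv.differentiable (by simp) ξ).hasDerivAt

theorem exists_bounds (ha : IsDispersionSymbol σ a) : ∃ c C : ℝ, 0 < c ∧ 0 < C ∧ ∀ ξ : ℝ,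
    c * japanese ξ ^ σ ≤ deriv (deriv a) ξ ∧ deriv (deriv a) ξ ≤ C * japanese ξ ^ σ := by
  obtain ⟨c, C, hc, h⟩ := ha.convexity
  rw [iteratedDeriv_two_eq] at h
  refine ⟨c, C, hc, ?_, h⟩
  have := (h 0).1.trans (h 0).2
  exact hc.trans_le (le_of_mul_le_mul_right this (japanese_rpow_pos 0 σ))

theorem deriv_deriv_pos (ha : IsDispersionSymbol σ a) (ξ : ℝ) : 0 < deriv (deriv a) ξ := by
  obtain ⟨c, C, hc, -, h⟩ := ha.exists_bounds
  exact (mul_pos hc (japanese_rpow_pos ξ σ)).trans_le (h ξ).1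

theorem strictMono_deriv (ha : IsDispersionSymbol σ a) : StrictMono (deriv a) :=
  strictMono_of_deriv_pos ha.deriv_deriv_pos

/-- The gain of decay with each derivative is discarded: one polynomial degree for all orders is
enough for temperate growth. -/
theorem exists_iteratedDeriv_bound (ha : IsDispersionSymbol σ a) (j : ℕ) :
    ∃ C : ℝ, 0 ≤ C ∧ ∀ ξ : ℝ,
      |iteratedDeriv (j + 1) (deriv a) ξ| ≤ C * (1 + |ξ|) ^ ⌈|σ|⌉₊ := by
  have key : ∃ C : ℝ, ∀ ξ, |iteratedDeriv (j + 2) a ξ| ≤ C * japanese ξ ^ σ := by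
    rcases j with _ | j
    · obtain ⟨c, C, hc, hC, h⟩ := ha.exists_bounds
      refine ⟨C, fun ξ ↦ ?_⟩
      rw [zero_add, iteratedDeriv_two_eq, abs_of_pos (ha.deriv_deriv_pos ξ)]
      exact (h ξ).2
    · obtain ⟨C, h⟩ := ha.symbol_bounds (j + 1) (by simp)
      refine ⟨|C|, fun ξ ↦ (h ξ).trans ?_⟩
      have h1 : japanese ξ ^ (σ - ((j + 1 : ℕ) : ℝ)) ≤ japanese ξ ^ σ :=
        Real.rpow_le_rpow_of_exponent_le (one_le_japanese ξ) (sub_le_self _ (Nat.cast_nonneg _))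
      exact mul_le_mul (le_abs_self C) h1 (japanese_rpow_pos ξ _).le (abs_nonneg C)
  obtain ⟨C, h⟩ := key
  refine ⟨|C|, abs_nonneg C, fun ξ ↦ ?_⟩
  rw [← iteratedDeriv_succ']
  refine (h ξ).trans ?_
  have h2 : japanese ξ ^ σ ≤ (1 + |ξ|) ^ ⌈|σ|⌉₊ := by
    rw [← Real.rpow_natCast]
    calc japanese ξ ^ σ ≤ japanese ξ ^ (⌈|σ|⌉₊ : ℝ) :=
          Real.rpow_le_rpow_of_exponent_le (one_le_japanese ξ)
            ((le_abs_self σ).trans (Nat.le_ceil _))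
      _ ≤ _ := Real.rpow_le_rpow (japanese_pos ξ).le (japanese_le_one_add_abs ξ) (by positivity)
  exact mul_le_mul (le_abs_self C) h2 (japanese_rpow_pos ξ σ).le (abs_nonneg C)

/-- Needed for a'(D) to act on tempered distributions as multiplication by a' on the Fourier side.
-/
theorem hasTemperateGrowth_deriv (ha : IsDispersionSymbol σ a) :
    (deriv a).HasTemperateGrowth := by
  refine ⟨ha.contDiff_deriv, fun n ↦ ?_⟩
  simp_rw [norm_iteratedFDeriv_eq_norm_iteratedDeriv]
  rcases n with _ | j
  · obtain ⟨C, hC, h⟩ := ha.exists_iteratedDeriv_bound 0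
    simp only [zero_add, iteratedDeriv_one] at h
    -- The symbol bounds say nothing about a' itself; the mean value inequality from 0 costs one
    -- more power of 1 + |ξ|.
    refine ⟨⌈|σ|⌉₊ + 1, |deriv a 0| + C, fun ξ ↦ ?_⟩
    rw [iteratedDeriv_zero]
    have hb : ∀ y ∈ Set.Icc (-|ξ|) |ξ|, ‖deriv (deriv a) y‖ ≤ C * (1 + |ξ|) ^ ⌈|σ|⌉₊ := by
      intro y hy
      refine (h y).trans ?_
      have : |y| ≤ |ξ| := abs_le.2 hy
      gcongr
    have := (convex_Icc (-|ξ|) |ξ|).norm_image_sub_le_of_norm_deriv_le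
      (fun y _ ↦ (ha.hasDerivAt_deriv y).differentiableAt) hb (x := 0) (y := ξ)
      (by simp) (abs_le.1 le_rfl)
    rw [sub_zero] at this
    have h3 : ‖deriv a ξ‖ ≤ ‖deriv a 0‖ + ‖deriv a ξ - deriv a 0‖ := by
      simpa using norm_add_le (deriv a 0) (deriv a ξ - deriv a 0)
    have h4 : |deriv a 0| ≤ |deriv a 0| * (1 + |ξ|) ^ (⌈|σ|⌉₊ + 1) :=
      le_mul_of_one_le_right (abs_nonneg _) (one_le_pow₀ (by simp))
    have h5 : C * (1 + |ξ|) ^ ⌈|σ|⌉₊ * |ξ| ≤ C * (1 + |ξ|) ^ (⌈|σ|⌉₊ + 1) := by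
      rw [pow_succ, ← mul_assoc]
      gcongr
      simp
    simp only [Real.norm_eq_abs] at *
    linarith
  · obtain ⟨C, -, h⟩ := ha.exists_iteratedDeriv_bound j
    exact ⟨_, C, h⟩

end IsDispersionSymbol

/-! ### Primitives of locally integrable functions and weak derivatives. -/

/-- `v` is a primitive of the locally integrable function `g`. -/
structure IsPrimitive (v g : ℝ → ℂ) : Prop where
  locallyIntegrable : LocallyIntegrable g
  eq_add_integral : ∀ x, v x = v 0 + ∫ y in (0 : ℝ)..x, g y

theorem MeasureTheory.LocallyIntegrable.intervalIntegrable {g : ℝ → ℂ}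
    (hg : LocallyIntegrable g) (a b : ℝ) : IntervalIntegrable g volume a b :=
  intervalIntegrable_iff.2
    ((hg.integrableOn_isCompact isCompact_uIcc).mono_set Set.uIoc_subset_uIcc)

namespace IsPrimitive

variable {v g : ℝ → ℂ}

theorem intervalIntegrable (h : IsPrimitive v g) (a b : ℝ) : IntervalIntegrable g volume a b :=
  h.locallyIntegrable.intervalIntegrable a b

theorem sub_eq (h : IsPrimitive v g) (a b : ℝ) : v b - v a = ∫ y in a..b, g y := by
  rw [h.eq_add_integral a, h.eq_add_integral b, add_sub_add_left_eq_sub,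
    intervalIntegral.integral_interval_sub_left (h.intervalIntegrable _ _)
      (h.intervalIntegrable _ _)]

theorem continuous (h : IsPrimitive v g) : Continuous v := by
  have : v = fun x ↦ v 0 + ∫ y in (0 : ℝ)..x, g y := funext h.eq_add_integral
  rw [this]
  exact continuous_const.add
    (intervalIntegral.continuous_primitive (fun a b ↦ h.intervalIntegrable a b) 0)

theorem ae_hasDerivAt (h : IsPrimitive v g) : ∀ᵐ x, HasDerivAt v (g x) x := by
  filter_upwards [_root_.LocallyIntegrable.ae_hasDerivAt_integral h.locallyIntegrable] with x hx
  have : v = fun x ↦ v 0 + ∫ y in (0 : ℝ)..x, g y := funext h.eq_add_integral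
  rw [this]
  exact (hx 0).const_add _

theorem absolutelyContinuousOnInterval (h : IsPrimitive v g) (a b : ℝ) :
    AbsolutelyContinuousOnInterval v a b := by
  have hre : IntervalIntegrable (fun x ↦ (g x).re) volume a b := by
    have := h.intervalIntegrable a b
    exact ⟨this.1.re, this.2.re⟩
  have him : IntervalIntegrable (fun x ↦ (g x).im) volume a b := by
    have := h.intervalIntegrable a b
    exact ⟨this.1.im, this.2.im⟩
  have hc (z : ℂ) : AbsolutelyContinuousOnInterval (fun _ : ℝ ↦ z) a b :=
    contDiffOn_const.absolutelyContinuousOnInterval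
  have h1 := ((hre.absolutelyContinuousOnInterval_intervalIntegral Set.left_mem_uIcc).fun_smul
    (hc 1)).fun_add ((him.absolutelyContinuousOnInterval_intervalIntegral
      Set.left_mem_uIcc).fun_smul (hc Complex.I))
  convert! (hc (v a)).fun_add h1 using 1
  funext x
  rw [← sub_eq_iff_eq_add', h.sub_eq]
  have hi := h.intervalIntegrable a x
  apply Complex.ext
  · simpa using! (Complex.reCLM.intervalIntegral_comp_comm hi).symm
  · simpa using! (Complex.imCLM.intervalIntegral_comp_comm hi).symm

/-- The fundamental theorem of calculus for the product of a primitive and a `C^1` function. -/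
theorem integral_mul_eq (h : IsPrimitive v g) {ρ : ℝ → ℂ} (hρ : ContDiff ℝ 1 ρ) (a b : ℝ) :
    ∫ x in a..b, ρ x * g x = ρ b * v b - ρ a * v a - ∫ x in a..b, deriv ρ x * v x := by
  have hρ' : Continuous (deriv ρ) := hρ.continuous_deriv le_rfl
  have h1 : LocallyIntegrable (fun x ↦ ρ x * g x) :=
    h.locallyIntegrable.continuous_mul hρ.continuous
  have h2 : LocallyIntegrable (fun x ↦ deriv ρ x * v x) :=
    (hρ'.mul h.continuous).locallyIntegrable
  have hP : IsPrimitive (fun x ↦ ∫ y in (0 : ℝ)..x, (ρ y * g y + deriv ρ y * v y))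
      (fun y ↦ ρ y * g y + deriv ρ y * v y) := ⟨h1.add h2, by simp⟩
  have hac : AbsolutelyContinuousOnInterval (fun x ↦ ρ x * v x -
      ∫ y in (0 : ℝ)..x, (ρ y * g y + deriv ρ y * v y)) a b :=
    (hρ.contDiffOn.absolutelyContinuousOnInterval.fun_smul
      (h.absolutelyContinuousOnInterval a b)).fun_sub (hP.absolutelyContinuousOnInterval a b)
  -- Since `g` is only locally integrable, the product rule holds almost everywhere; absolute
  -- continuity turns the vanishing derivative into constancy.
  obtain ⟨C, hC⟩ := hac.const_of_ae_hasDerivAt_zero (by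
    filter_upwards [h.ae_hasDerivAt, hP.ae_hasDerivAt] with x hx hx' _
    convert! ((hρ.differentiable one_ne_zero x).hasDerivAt.mul hx).sub hx' using 1
    ring)
  have ha := hC a Set.left_mem_uIcc
  have hb := hC b Set.right_mem_uIcc
  have h3 := hP.sub_eq a b
  rw [intervalIntegral.integral_add (h1.intervalIntegrable a b)
    (h2.intervalIntegrable a b)] at h3
  linear_combination ha - hb - h3

theorem integral_mul_eq_neg (h : IsPrimitive v g) {ρ : ℝ → ℂ} (hρ : ContDiff ℝ 1 ρ)
    (hc : HasCompactSupport ρ) : ∫ x, deriv ρ x * v x = -∫ x, ρ x * g x := by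
  obtain ⟨R, hR⟩ := hc.isCompact.isBounded.subset_ball_lt 0 0
  have hsub {f : ℝ → ℂ} (hf : tsupport f ⊆ tsupport ρ) (u : ℝ → ℂ) :
      Function.support (fun x ↦ f x * u x) ⊆ Set.Ioc (-R) R := by
    intro x hx
    have h1 : x ∈ tsupport f := subset_tsupport f fun h0 ↦ hx (by simp [h0])
    have h2 := hR.2 (hf h1)
    rw [Real.ball_eq_Ioo] at h2
    exact ⟨by linarith [h2.1], by linarith [h2.2]⟩
  have hz {x : ℝ} (hx : ¬ |x| < R) : ρ x = 0 := by
    by_contra h0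
    have := hR.2 (subset_tsupport ρ h0)
    exact hx (by simpa using this)
  rw [← intervalIntegral.integral_eq_integral_of_support_subset (hsub tsupport_deriv_subset v),
    ← intervalIntegral.integral_eq_integral_of_support_subset (hsub subset_rfl g),
    h.integral_mul_eq hρ, hz (x := R) (by simp [le_abs_self]), hz (x := -R) (by simp [le_abs_self])]
  ring

end IsPrimitive

/-- The primitive that starts to the left of the support is zero there, and to the right of the
support it equals the total integral, which is zero. -/
theorem exists_deriv_eq_of_integral_eq_zero {θ : ℝ → ℝ} (hθ : ContDiff ℝ ∞ θ)
    (hc : HasCompactSupport θ) (h0 : ∫ x, θ x = 0) :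
    ∃ ψ : ℝ → ℝ, ContDiff ℝ ∞ ψ ∧ HasCompactSupport ψ ∧ deriv ψ = θ := by
  obtain ⟨R, hR⟩ := hc.isCompact.isBounded.subset_ball_lt 0 0
  have hz {x : ℝ} (hx : ¬ |x| < R) : θ x = 0 := by
    by_contra h0
    have := hR.2 (subset_tsupport θ h0)
    exact hx (by simpa using this)
  have hd (x : ℝ) : HasDerivAt (fun x ↦ ∫ y in (-R)..x, θ y) (θ x) x :=
    intervalIntegral.integral_hasDerivAt_right (hθ.continuous.intervalIntegrable _ _)
      (hθ.continuous.stronglyMeasurableAtFilter _ _) hθ.continuous.continuousAt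
  have hderiv : deriv (fun x ↦ ∫ y in (-R)..x, θ y) = θ := funext fun x ↦ (hd x).deriv
  refine ⟨fun x ↦ ∫ y in (-R)..x, θ y, ?_, ?_, hderiv⟩
  · rw [contDiff_infty_iff_deriv, hderiv]
    exact ⟨fun x ↦ (hd x).differentiableAt, hθ⟩
  · refine HasCompactSupport.of_support_subset_isCompact (isCompact_Icc (a := -R) (b := R)) ?_
    intro x hx
    by_contra hx'
    refine hx ?_
    rw [Set.mem_Icc, not_and_or, not_le, not_le] at hx'
    rcases hx' with hx' | hx'
    · refine intervalIntegral.integral_zero_ae (Filter.Eventually.of_forall fun y hy ↦ hz ?_)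
      rw [Set.uIoc_of_ge hx'.le] at hy
      intro h
      linarith [hy.2, (abs_lt.1 h).1]
    · change ∫ y in (-R)..x, θ y = 0
      rw [intervalIntegral.integral_eq_integral_of_support_subset, h0]
      intro y hy
      have : |y| < R := by
        by_contra h
        exact hy (hz h)
      exact ⟨(abs_lt.1 this).1, (abs_lt.1 this).2.le.trans hx'.le⟩

/-- The lemma of du Bois-Reymond. -/
theorem ae_eq_const_of_integral_deriv_smul_eq_zero {D : ℝ → ℂ} (hD : LocallyIntegrable D)
    (h : ∀ ψ : ℝ → ℝ, ContDiff ℝ ∞ ψ → HasCompactSupport ψ → ∫ x, deriv ψ x • D x = 0) :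
    ∃ c : ℂ, ∀ᵐ x, D x = c := by
  let b : ContDiffBump (0 : ℝ) := ⟨1, 2, one_pos, one_lt_two⟩
  set ρ := b.normed volume
  have hρ : ContDiff ℝ ∞ ρ := b.contDiff_normed
  have hρc : HasCompactSupport ρ := b.hasCompactSupport_normed
  refine ⟨∫ x, ρ x • D x, ?_⟩
  have key : ∀ᵐ x, D x - ∫ x, ρ x • D x = 0 := by
    refine ae_eq_zero_of_integral_contDiff_smul_eq_zero
      (hD.sub (continuous_const.locallyIntegrable)) fun φ hφ hφc ↦ ?_
    have hi {f : ℝ → ℝ} (hf : ContDiff ℝ ∞ f) (hfc : HasCompactSupport f) :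
        Integrable fun x ↦ f x • D x :=
      hD.integrable_smul_left_of_hasCompactSupport hf.continuous hfc
    have hi' {f : ℝ → ℝ} (hf : ContDiff ℝ ∞ f) (hfc : HasCompactSupport f) : Integrable f :=
      hf.continuous.integrable_of_hasCompactSupport hfc
    -- Subtracting the multiple of `ρ` with the same mean makes any test function a derivative.
    obtain ⟨ψ, hψ, hψc, hψd⟩ := exists_deriv_eq_of_integral_eq_zero
      (θ := fun x ↦ φ x - (∫ y, φ y) * ρ x) (hφ.sub (contDiff_const.mul hρ))
      (hφc.sub hρc.mul_left) (by
        rw [integral_sub (hi' hφ hφc) ((hi' hρ hρc).const_mul _), integral_const_mul,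
          b.integral_normed, mul_one, sub_self])
    have h1 := h ψ hψ hψc
    rw [hψd] at h1
    simp_rw [sub_smul, mul_smul] at h1
    rw [integral_sub (hi hφ hφc) ((hi hρ hρc).fun_smul _), integral_smul] at h1
    simp_rw [smul_sub]
    rw [integral_sub (hi hφ hφc) ((hi' hφ hφc).smul_const _), integral_smul_const]
    exact h1
  filter_upwards [key] with x hx using sub_eq_zero.1 hx

/-- A locally integrable function with a locally integrable weak derivative is a primitive of it. -/
theorem exists_isPrimitive_ae_eq {V G : ℝ → ℂ} (hV : LocallyIntegrable V)
    (hG : LocallyIntegrable G) (h : ∀ ψ : ℝ → ℂ, ContDiff ℝ ∞ ψ → HasCompactSupport ψ →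
      ∫ x, deriv ψ x * V x = -∫ x, ψ x * G x) :
    ∃ v : ℝ → ℂ, IsPrimitive v G ∧ V =ᵐ[volume] v := by
  have hP : IsPrimitive (fun x ↦ ∫ y in (0 : ℝ)..x, G y) G := ⟨hG, by simp⟩
  obtain ⟨c, hc⟩ := ae_eq_const_of_integral_deriv_smul_eq_zero
    (hV.sub hP.continuous.locallyIntegrable) (by
      intro ψ hψ hψc
      have h1 : ContDiff ℝ ∞ (fun x ↦ (ψ x : ℂ)) := Complex.ofRealCLM.contDiff.comp hψ
      have h2 : HasCompactSupport (fun x ↦ (ψ x : ℂ)) := hψc.comp_left Complex.ofReal_zero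
      have hd : deriv (fun x ↦ (ψ x : ℂ)) = fun x ↦ ((deriv ψ x : ℝ) : ℂ) := funext fun x ↦
        ((hψ.differentiable (by simp) x).hasDerivAt.ofReal_comp).deriv
      have h3 := h _ h1 h2
      have h4 := hP.integral_mul_eq_neg (h1.of_le (by simp)) h2
      rw [hd] at h3 h4
      have hi {f : ℝ → ℂ} (hf : LocallyIntegrable f) :
          Integrable fun x ↦ ((deriv ψ x : ℝ) : ℂ) * f x :=
        hf.integrable_smul_left_of_hasCompactSupport (g := fun x ↦ ((deriv ψ x : ℝ) : ℂ))
          (Complex.continuous_ofReal.comp (hψ.continuous_deriv (by simp)))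
          (hψc.deriv.comp_left Complex.ofReal_zero)
      simp only [Pi.sub_apply, Complex.real_smul, mul_sub]
      rw [integral_sub (hi hV) (hi hP.continuous.locallyIntegrable), h3, h4, sub_self])
  refine ⟨fun x ↦ c + ∫ y in (0 : ℝ)..x, G y, ⟨hG, by simp⟩, ?_⟩
  filter_upwards [hc] with x hx
  rw [← hx]
  simp

/-! ### The inverse Fourier integral on L¹ ∩ L². -/

theorem continuous_innerₗ_neg : Continuous fun p : ℝ × ℝ ↦ (-innerₗ ℝ) p.1 p.2 := by
  simp only [LinearMap.neg_apply, innerₗ_apply_apply]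
  fun_prop

theorem continuous_fourierInv {w : ℝ → ℂ} (hw : Integrable w) : Continuous (𝓕⁻ w) :=
  VectorFourier.fourierIntegral_continuous Real.continuous_fourierChar continuous_innerₗ_neg hw

theorem integral_mul_fourierInv {w : ℝ → ℂ} (hw : Integrable w) (φ : 𝓢(ℝ, ℂ)) :
    ∫ x, φ x * 𝓕⁻ w x = ∫ η, 𝓕⁻ φ η * w η := by
  have := VectorFourier.integral_fourierIntegral_smul_eq_flip (L := -innerₗ ℝ) (μ := volume)
    (ν := volume) Real.continuous_fourierChar continuous_innerₗ_neg φ.integrable hw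
  have hflip : (-innerₗ ℝ).flip = -innerₗ ℝ := by
    ext
    simp
  rw [hflip] at this
  simp only [smul_eq_mul] at this
  rw [fourierInv_coe]
  exact this.symm

/-- Plancherel's theorem for the inverse Fourier integral of a function in `L^1 ∩ L^2`. -/
theorem fourierInv_toLp_ae_eq {w : ℝ → ℂ} (h₁ : Integrable w) (h₂ : MemLp w 2) :
    (𝓕⁻ (h₂.toLp w) : Lp ℂ 2 (volume : Measure ℝ)) =ᵐ[volume] 𝓕⁻ w := by
  have hcont := continuous_fourierInv h₁
  refine ae_eq_of_integral_contDiff_smul_eq ((Lp.memLp _).locallyIntegrable one_le_two)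
    hcont.locallyIntegrable fun φ hφ hφc ↦ ?_
  have hg₁ : HasCompactSupport (Complex.ofRealCLM ∘ φ) := hφc.comp_left rfl
  have hg₂ : ContDiff ℝ ∞ (Complex.ofRealCLM ∘ φ) := by fun_prop
  have h := congrArg (fun u : 𝓢'(ℝ, ℂ) ↦ u (hg₁.toSchwartzMap hg₂))
    (Lp.fourierInv_toTemperedDistribution_eq (h₂.toLp w))
  simp only [TemperedDistribution.fourierInv_apply, Lp.toTemperedDistribution_apply] at h
  have h3 : ∫ x, 𝓕⁻ (hg₁.toSchwartzMap hg₂) x • h₂.toLp w x =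
      ∫ x, 𝓕⁻ (hg₁.toSchwartzMap hg₂) x * w x :=
    integral_congr_ae (h₂.coeFn_toLp.mono fun x hx ↦ by simp [hx])
  rw [h3, ← integral_mul_fourierInv h₁] at h
  simpa using h.symm

theorem memLp_fourierInv {w : ℝ → ℂ} (h₁ : Integrable w) (h₂ : MemLp w 2) : MemLp (𝓕⁻ w) 2 :=
  (memLp_congr_ae (fourierInv_toLp_ae_eq h₁ h₂)).1 (Lp.memLp _)

theorem eLpNorm_fourierInv {w : ℝ → ℂ} (h₁ : Integrable w) (h₂ : MemLp w 2) :
    eLpNorm (𝓕⁻ w) 2 = eLpNorm w 2 := by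
  rw [← eLpNorm_congr_ae (fourierInv_toLp_ae_eq h₁ h₂), ← eLpNorm_congr_ae h₂.coeFn_toLp,
    ← Lp.enorm_def, ← Lp.enorm_def]
  exact congrArg ENNReal.ofNNReal (NNReal.eq ((Lp.fourierTransformₗᵢ ℝ ℂ).symm.norm_map _))

/-! ### Lebesgue norms of distributions and the norm of X. -/

theorem toTemperedDistribution_injective {p : ℝ≥0∞} [Fact (1 ≤ p)] :
    Function.Injective
      (fun f : Lp ℂ p (volume : Measure ℝ) ↦ (f : 𝓢'(ℝ, ℂ))) :=
  LinearMap.ker_eq_bot.1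
    (Lp.ker_toTemperedDistributionCLM_eq_bot (F := ℂ) (μ := (volume : Measure ℝ)) (p := p))

theorem distLpNorm_coe {p : ℝ≥0∞} [Fact (1 ≤ p)] (f : Lp ℂ p (volume : Measure ℝ)) :
    distLpNorm p (f : 𝓢'(ℝ, ℂ)) = ‖f‖ₑ := by
  refine le_antisymm (iInf₂_le_of_le f rfl le_rfl) (le_iInf₂ fun g hg ↦ ?_)
  rw [toTemperedDistribution_injective hg]

theorem exists_of_distLpNorm_lt_top {p : ℝ≥0∞} [Fact (1 ≤ p)] {u : 𝓢'(ℝ, ℂ)}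
    (h : distLpNorm p u < ⊤) :
    ∃ f : Lp ℂ p (volume : Measure ℝ), (f : 𝓢'(ℝ, ℂ)) = u ∧ ‖f‖ₑ = distLpNorm p u := by
  obtain ⟨f, hf⟩ := iInf_lt_iff.1 h
  obtain ⟨hfu, -⟩ := iInf_lt_iff.1 hf
  exact ⟨f, hfu, by rw [← hfu, distLpNorm_coe]⟩

theorem ENNReal.le_rpow_half_of_sq_le {x y : ℝ≥0∞} (h : x ^ 2 ≤ y) : x ≤ y ^ (1 / 2 : ℝ) := by
  rw [one_div, ENNReal.le_rpow_inv_iff two_pos]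
  exact_mod_cast h

theorem distLpNorm_japaneseD_le_normX (a : ℝ → ℝ) (s₀ s₁ t : ℝ) (u : 𝓢'(ℝ, ℂ)) :
    distLpNorm 2 (japaneseD s₀ u) ≤ normX a s₀ s₁ t u :=
  ENNReal.le_rpow_half_of_sq_le le_self_add

theorem distLpNorm_vectorField_le_normX (a : ℝ → ℝ) (s₀ s₁ t : ℝ) (u : 𝓢'(ℝ, ℂ)) :
    distLpNorm 2 (japaneseD s₁ (vectorField a t u)) ≤ normX a s₀ s₁ t u :=
  ENNReal.le_rpow_half_of_sq_le le_add_self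

/-! ### The profile of a distribution in X. -/

/-- The symbol of `⟨D⟩^s` in the variable `η` of Mathlib's Fourier transform. -/
noncomputable def weight (s η : ℝ) : ℝ := japanese (2 * Real.pi * η) ^ s

/-- The factor `e^{i t a(ξ)}` at `ξ = 2 π η`. -/
noncomputable def modulation (a : ℝ → ℝ) (t η : ℝ) : ℂ :=
  Complex.exp (((t * a (2 * Real.pi * η) : ℝ) : ℂ) * Complex.I)

theorem weight_pos (s η : ℝ) : 0 < weight s η := japanese_rpow_pos _ s

theorem weight_neg_mul (s η : ℝ) : (weight (-s) η : ℂ) * weight s η = 1 := by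
  rw [← Complex.ofReal_mul, weight, weight, ← Real.rpow_add (japanese_pos _), neg_add_cancel,
    Real.rpow_zero, Complex.ofReal_one]

theorem hasTemperateGrowth_weight (s : ℝ) : (fun η ↦ (weight s η : ℂ)).HasTemperateGrowth :=
  hasTemperateGrowth_scaled (hasTemperateGrowth_japanese_rpow s)

theorem continuous_weight (s : ℝ) : Continuous fun η ↦ (weight s η : ℂ) :=
  (hasTemperateGrowth_weight s).1.continuous

theorem norm_modulation (a : ℝ → ℝ) (t η : ℝ) : ‖modulation a t η‖ = 1 :=
  Complex.norm_exp_ofReal_mul_I _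

theorem modulation_neg_mul (a : ℝ → ℝ) (t η : ℝ) :
    modulation a (-t) η * modulation a t η = 1 := by
  rw [modulation, modulation, ← Complex.exp_add]
  simp

theorem IsDispersionSymbol.contDiff_modulation {σ : ℝ} {a : ℝ → ℝ} (ha : IsDispersionSymbol σ a)
    (t : ℝ) : ContDiff ℝ ∞ (modulation a t) := by
  have h1 : ContDiff ℝ ∞ fun η : ℝ ↦ t * a (2 * Real.pi * η) :=
    contDiff_const.mul (ha.smooth.comp (contDiff_const.mul contDiff_id))
  exact ((Complex.ofRealCLM.contDiff.comp h1).mul contDiff_const).cexp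

theorem IsDispersionSymbol.hasDerivAt_scaled {σ : ℝ} {a : ℝ → ℝ} (ha : IsDispersionSymbol σ a)
    (η : ℝ) : HasDerivAt (fun η ↦ a (2 * Real.pi * η))
      (2 * Real.pi * deriv a (2 * Real.pi * η)) η := by
  have h0 : HasDerivAt (fun η : ℝ ↦ 2 * Real.pi * η) (2 * Real.pi) η := by
    simpa using (hasDerivAt_id η).const_mul (2 * Real.pi)
  convert! (ha.hasDerivAt (2 * Real.pi * η)).comp η h0 using 1
  ring

theorem IsDispersionSymbol.hasDerivAt_modulation {σ : ℝ} {a : ℝ → ℝ}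
    (ha : IsDispersionSymbol σ a) (t η : ℝ) : HasDerivAt (modulation a t)
      (2 * Real.pi * Complex.I * t * deriv a (2 * Real.pi * η) * modulation a t η) η := by
  have h1 := (((ha.hasDerivAt_scaled η).const_mul t).ofReal_comp.mul_const Complex.I).cexp
  convert! h1 using 1
  rw [modulation]
  push_cast
  ring

/-- The profile `v = e^{i t a} û` of `u`, its derivative `g`, and the bounds that the norm of `u`
in `X` gives for them. -/
structure IsProfile (a : ℝ → ℝ) (s₀ s₁ t : ℝ) (u : 𝓢'(ℝ, ℂ)) (v g : ℝ → ℂ) : Prop where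
  primitive : IsPrimitive v g
  memLp : MemLp (fun η ↦ (weight s₀ η : ℂ) * v η) 2
  memLp_deriv : MemLp (fun η ↦ (weight s₁ η : ℂ) * g η) 2
  eLpNorm_le : eLpNorm (fun η ↦ (weight s₀ η : ℂ) * v η) 2 ≤ normX a s₀ s₁ t u
  eLpNorm_deriv_le : eLpNorm (fun η ↦ (weight s₁ η : ℂ) * g η) 2 ≤
    ENNReal.ofReal (2 * Real.pi) * normX a s₀ s₁ t u
  fourier_apply : ∀ φ : 𝓢(ℝ, ℂ), 𝓕 u φ = ∫ η, φ η * (modulation a (-t) η * v η)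

theorem exists_fourier_eq_of_japaneseD {s : ℝ} {u : 𝓢'(ℝ, ℂ)}
    (h : distLpNorm 2 (japaneseD s u) < ⊤) :
    ∃ F : ℝ → ℂ, MemLp F 2 ∧ eLpNorm F 2 = distLpNorm 2 (japaneseD s u) ∧
      ∀ φ : 𝓢(ℝ, ℂ), 𝓕 u φ = ∫ η, φ η * ((weight (-s) η : ℂ) * F η) := by
  obtain ⟨f, hf, hfn⟩ := exists_of_distLpNorm_lt_top h
  refine ⟨(𝓕 f : Lp ℂ 2 (volume : Measure ℝ)), Lp.memLp _, ?_, fun φ ↦ ?_⟩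
  · rw [← Lp.enorm_def, ← hfn]
    exact congrArg ENNReal.ofNNReal (NNReal.eq (Lp.norm_fourier_eq f))
  · have h1 : 𝓕 (japaneseD s u) =
        TemperedDistribution.smulLeftCLM ℂ (fun η ↦ (weight s η : ℂ)) (𝓕 u) := by
      rw [japaneseD, multiplier, TemperedDistribution.fourierMultiplierCLM_apply,
        fourier_fourierInv_eq]
      rfl
    -- Testing against φ times the inverse weight recovers the transform of `u` itself.
    have h2 := congrArg (fun T : 𝓢'(ℝ, ℂ) ↦
      T (SchwartzMap.smulLeftCLM ℂ (fun η ↦ (weight (-s) η : ℂ)) φ)) h1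
    rw [← hf, Lp.fourier_toTemperedDistribution_eq] at h2
    simp only [Lp.toTemperedDistribution_apply, TemperedDistribution.smulLeftCLM_apply_apply] at h2
    rw [SchwartzMap.smulLeftCLM_smulLeftCLM_apply (hasTemperateGrowth_weight _)
      (hasTemperateGrowth_weight _)] at h2
    have h3 : ((fun η ↦ (weight s η : ℂ)) * fun η ↦ (weight (-s) η : ℂ)) = fun _ ↦ 1 := by
      funext η
      rw [Pi.mul_apply, mul_comm, weight_neg_mul]
    rw [h3, SchwartzMap.smulLeftCLM_const, one_smul] at h2
    rw [ContinuousLinearMap.id_apply] at h2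
    rw [← h2]
    refine integral_congr_ae (.of_forall fun η ↦ ?_)
    simp only [SchwartzMap.smulLeftCLM_apply_apply (hasTemperateGrowth_weight (-s)), smul_eq_mul]
    ring

theorem coe_toSchwartzMap {f : ℝ → ℂ} (h₁ : HasCompactSupport f) (h₂ : ContDiff ℝ ∞ f) :
    ⇑(h₁.toSchwartzMap h₂) = f := rfl

/-- Multiplication by x is dual to differentiation of the test function, with the factor 2πi of this
normalisation of the Fourier transform. -/
theorem fourier_vectorField_apply (a : ℝ → ℝ) (t : ℝ) (u : 𝓢'(ℝ, ℂ)) (φ : 𝓢(ℝ, ℂ)) :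
    2 * Real.pi * Complex.I * 𝓕 (vectorField a t u) φ =
      𝓕 u (SchwartzMap.derivCLM ℂ ℂ φ) - 2 * Real.pi * Complex.I * t *
        𝓕 u (SchwartzMap.smulLeftCLM ℂ
          (fun η : ℝ ↦ ((deriv a (2 * Real.pi * η) : ℝ) : ℂ)) φ) := by
  have h1 : 𝓕 (SchwartzMap.derivCLM ℂ ℂ φ) = (2 * Real.pi * Complex.I) •
      SchwartzMap.smulLeftCLM ℂ (fun x : ℝ ↦ (x : ℂ)) (𝓕 φ) := by
    ext x
    have h2 := congrFun (Real.fourier_deriv (f := φ) φ.integrable φ.differentiable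
      (SchwartzMap.derivCLM ℂ ℂ φ).integrable) x
    rw [smul_apply, SchwartzMap.smulLeftCLM_apply_apply
      Function.Complex.hasTemperateGrowth_ofReal, fourier_coe, fourier_coe]
    simp only [smul_eq_mul] at h2 ⊢
    rw [← mul_assoc, ← h2]
    rfl
  have h3 : multiplier (deriv a) u (𝓕 φ) = 𝓕 u (SchwartzMap.smulLeftCLM ℂ
      (fun η : ℝ ↦ ((deriv a (2 * Real.pi * η) : ℝ) : ℂ)) φ) := by
    rw [multiplier, TemperedDistribution.fourierMultiplierCLM_apply_apply, fourierInv_fourier_eq]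
    rfl
  simp only [TemperedDistribution.fourier_apply] at h3 ⊢
  rw [h1, map_smul, ← h3, vectorField]
  have h4 : (TemperedDistribution.smulLeftCLM ℂ (fun x : ℝ ↦ (x : ℂ)) u -
      (t : ℂ) • multiplier (deriv a) u) (𝓕 φ) =
      u (SchwartzMap.smulLeftCLM ℂ (fun x : ℝ ↦ (x : ℂ)) (𝓕 φ)) -
        t * multiplier (deriv a) u (𝓕 φ) := rfl
  rw [h4, smul_eq_mul]
  ring

/-- The vector field L is conjugate to a pure derivative: e^{ita} times the transform of `u` has a
weak derivative equal to -2πi e^{ita} times the transform of `Lu`. The modulation is unimodular, so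
it does not affect L² norms. -/
theorem IsDispersionSymbol.exists_isProfile {σ : ℝ} {a : ℝ → ℝ} (ha : IsDispersionSymbol σ a)
    {s₀ s₁ t : ℝ} {u : 𝓢'(ℝ, ℂ)} (hu : normX a s₀ s₁ t u < ⊤) :
    ∃ v g, IsProfile a s₀ s₁ t u v g := by
  obtain ⟨F, hF, hFn, hFu⟩ := exists_fourier_eq_of_japaneseD
    ((distLpNorm_japaneseD_le_normX a s₀ s₁ t u).trans_lt hu)
  obtain ⟨G, hG, hGn, hGu⟩ := exists_fourier_eq_of_japaneseD
    ((distLpNorm_vectorField_le_normX a s₀ s₁ t u).trans_lt hu)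
  have hE := (ha.contDiff_modulation t).continuous
  have hw : LocallyIntegrable fun η ↦ (weight (-s₀) η : ℂ) * F η :=
    (hF.locallyIntegrable one_le_two).continuous_mul (continuous_weight _)
  have hg : LocallyIntegrable fun η ↦ (weight (-s₁) η : ℂ) * G η :=
    (hG.locallyIntegrable one_le_two).continuous_mul (continuous_weight _)
  obtain ⟨v, hv, hVv⟩ := exists_isPrimitive_ae_eq
    (V := fun η ↦ modulation a t η * ((weight (-s₀) η : ℂ) * F η))
    (G := fun η ↦ -(2 * Real.pi * Complex.I) * modulation a t η * ((weight (-s₁) η : ℂ) * G η))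
    (hw.continuous_mul hE) (hg.continuous_mul (continuous_const.mul hE)) (by
      intro ψ hψ hψc
      -- With the test function e^{ita} ψ, the derivative of the modulation cancels the a' term
      -- exactly, and only e^{ita} ψ' is left.
      have hφ : ContDiff ℝ ∞ fun η ↦ modulation a t η * ψ η := (ha.contDiff_modulation t).mul hψ
      have hφc : HasCompactSupport fun η ↦ modulation a t η * ψ η := hψc.mul_left
      have h1 := fourier_vectorField_apply a t u (hφc.toSchwartzMap hφ)
      have hm := hasTemperateGrowth_scaled ha.hasTemperateGrowth_deriv
      rw [hFu, hFu, hGu] at h1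
      simp only [SchwartzMap.smulLeftCLM_apply_apply hm, SchwartzMap.derivCLM_apply,
        coe_toSchwartzMap, smul_eq_mul] at h1
      have hd (η : ℝ) : deriv (fun η ↦ modulation a t η * ψ η) η =
          2 * Real.pi * Complex.I * t * deriv a (2 * Real.pi * η) * modulation a t η * ψ η +
            modulation a t η * deriv ψ η :=
        ((ha.hasDerivAt_modulation t η).mul
          (hψ.differentiable (by simp) η).hasDerivAt).deriv
      have hi {f : ℝ → ℂ} (hf : Continuous f) (hfc : HasCompactSupport f) :
          Integrable fun η ↦ f η * ((weight (-s₀) η : ℂ) * F η) :=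
        hw.integrable_smul_left_of_hasCompactSupport hf hfc
      have h2 : Integrable fun η ↦ (modulation a t η * deriv ψ η) *
          ((weight (-s₀) η : ℂ) * F η) :=
        hi (hE.mul (hψ.continuous_deriv (by simp))) hψc.deriv.mul_left
      have h3 : Integrable fun η ↦ (2 * Real.pi * Complex.I * t * deriv a (2 * Real.pi * η) *
          modulation a t η * ψ η) * ((weight (-s₀) η : ℂ) * F η) :=
        hi ((((continuous_const.mul hm.1.continuous).mul hE)).mul hψ.continuous) hψc.mul_left
      simp only [hd, add_mul] at h1
      rw [integral_add h3 h2] at h1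
      have h4 : ∫ η, (2 * Real.pi * Complex.I * t * deriv a (2 * Real.pi * η) *
          modulation a t η * ψ η) * ((weight (-s₀) η : ℂ) * F η) =
          2 * Real.pi * Complex.I * t * ∫ η, ((deriv a (2 * Real.pi * η) : ℝ) : ℂ) *
            (modulation a t η * ψ η) * ((weight (-s₀) η : ℂ) * F η) := by
        rw [← integral_const_mul]
        congr 1
        funext η
        ring
      rw [h4, add_sub_cancel_left, ← integral_const_mul] at h1
      rw [← integral_neg]
      calc ∫ η, deriv ψ η * (modulation a t η * ((weight (-s₀) η : ℂ) * F η))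
          = ∫ η, (modulation a t η * deriv ψ η) * ((weight (-s₀) η : ℂ) * F η) := by
            congr 1
            funext η
            ring
        _ = _ := by
            rw [← h1]
            congr 1
            funext η
            ring)
  have hev : (fun η ↦ (weight s₀ η : ℂ) * v η) =ᵐ[volume] fun η ↦ modulation a t η * F η := by
    filter_upwards [hVv] with η hη
    rw [← hη]
    linear_combination (modulation a t η * F η) * weight_neg_mul s₀ η
  have heg (η : ℝ) : (weight s₁ η : ℂ) * (-(2 * Real.pi * Complex.I) * modulation a t η *
      ((weight (-s₁) η : ℂ) * G η)) = -(2 * Real.pi * Complex.I) * (modulation a t η * G η) := by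
    linear_combination (-(2 * Real.pi * Complex.I) * modulation a t η * G η) * weight_neg_mul s₁ η
  have hmod {H : ℝ → ℂ} (hH : MemLp H 2) : MemLp (fun η ↦ modulation a t η * H η) 2 :=
    hH.of_le (hE.aestronglyMeasurable.fun_mul hH.1)
      (.of_forall fun η ↦ by rw [norm_mul, norm_modulation, one_mul])
  have hmodn (H : ℝ → ℂ) : eLpNorm (fun η ↦ modulation a t η * H η) 2 = eLpNorm H 2 :=
    eLpNorm_congr_norm_ae (.of_forall fun η ↦ by rw [norm_mul, norm_modulation, one_mul])
  refine ⟨v, _, hv, ?_, ?_, ?_, ?_, fun φ ↦ ?_⟩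
  · exact (memLp_congr_ae hev).2 (hmod hF)
  · simp_rw [heg]
    exact (hmod hG).const_mul _
  · rw [eLpNorm_congr_ae hev, hmodn, hFn]
    exact distLpNorm_japaneseD_le_normX a s₀ s₁ t u
  · simp_rw [heg]
    have h1 := eLpNorm_const_smul (-(2 * Real.pi * Complex.I)) (fun η ↦ modulation a t η * G η)
      2 volume
    have h2 : ‖-(2 * (Real.pi : ℂ) * Complex.I)‖ₑ = ENNReal.ofReal (2 * Real.pi) := by
      rw [← ofReal_norm]
      congr 1
      simp [abs_of_pos Real.pi_pos]
    rw [h2, hmodn, hGn] at h1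
    refine (le_of_eq h1).trans ?_
    gcongr
    exact distLpNorm_vectorField_le_normX a s₀ s₁ t u
  · rw [hFu]
    refine integral_congr_ae ?_
    filter_upwards [hVv] with η hη
    rw [← hη]
    linear_combination (-φ η * (weight (-s₀) η : ℂ) * F η) * modulation_neg_mul a t η

/-! ### Cauchy-Schwarz and interpolation on intervals. -/

theorem Continuous.memLp_restrict_Ioc {E : Type*} [NormedAddCommGroup E] {f : ℝ → E}
    (hf : Continuous f) (p : ℝ≥0∞) (α β : ℝ) : MemLp f p (volume.restrict (Set.Ioc α β)) := by
  obtain ⟨C, hC⟩ := isCompact_Icc.exists_bound_of_continuousOn (hf.continuousOn (s := Set.Icc α β))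
  refine MemLp.of_bound hf.aestronglyMeasurable C ?_
  exact (ae_restrict_iff' measurableSet_Ioc).2
    (.of_forall fun x hx ↦ hC x (Set.Ioc_subset_Icc_self hx))

/-- The Cauchy-Schwarz inequality on an interval. -/
theorem intervalIntegral_norm_mul_norm_le {E F : Type*} [NormedAddCommGroup E]
    [NormedAddCommGroup F] {f : ℝ → E} {g : ℝ → F} {α β A B : ℝ} (hαβ : α ≤ β)
    (hf : MemLp f 2 (volume.restrict (Set.Ioc α β)))
    (hg : MemLp g 2 (volume.restrict (Set.Ioc α β))) (hA : 0 ≤ A) (hB : 0 ≤ B)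
    (hfA : ∫ x in α..β, ‖f x‖ ^ 2 ≤ A ^ 2) (hgB : ∫ x in α..β, ‖g x‖ ^ 2 ≤ B ^ 2) :
    ∫ x in α..β, ‖f x‖ * ‖g x‖ ≤ A * B := by
  have h2 : ENNReal.ofReal 2 = 2 := by simp
  have h := integral_mul_le_Lp_mul_Lq_of_nonneg (μ := volume.restrict (Set.Ioc α β))
    Real.HolderConjugate.two_two (f := fun x ↦ ‖f x‖) (g := fun x ↦ ‖g x‖)
    (.of_forall fun x ↦ norm_nonneg _) (.of_forall fun x ↦ norm_nonneg _)
    (by rw [h2]; exact hf.norm) (by rw [h2]; exact hg.norm)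
  simp_rw [Real.rpow_two, ← Real.sqrt_eq_rpow] at h
  rw [intervalIntegral.integral_of_le hαβ] at *
  exact h.trans (mul_le_mul (Real.sqrt_le_iff.2 ⟨hA, hfA⟩) (Real.sqrt_le_iff.2 ⟨hB, hgB⟩)
    (Real.sqrt_nonneg _) hA)

theorem intervalIntegrable_norm_mul_norm {E F : Type*} [NormedAddCommGroup E]
    [NormedAddCommGroup F] {f : ℝ → E} {g : ℝ → F} {α β : ℝ} (hαβ : α ≤ β)
    (hf : MemLp f 2 (volume.restrict (Set.Ioc α β)))
    (hg : MemLp g 2 (volume.restrict (Set.Ioc α β))) :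
    IntervalIntegrable (fun x ↦ ‖f x‖ * ‖g x‖) volume α β :=
  (intervalIntegrable_iff_integrableOn_Ioc_of_le hαβ).2 (hf.norm.integrable_mul hg.norm)

/-- An interpolation inequality of Gagliardo-Nirenberg type on an interval that is not too short. -/
theorem IsPrimitive.norm_le {v g : ℝ → ℂ} (h : IsPrimitive v g) {α β A B : ℝ}
    (hg : MemLp g 2 (volume.restrict (Set.Ioc α β))) (hA : 0 < A) (hB : 0 < B)
    (hvA : ∫ x in α..β, ‖v x‖ ^ 2 ≤ A ^ 2) (hgB : ∫ x in α..β, ‖g x‖ ^ 2 ≤ B ^ 2)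
    (hAB : A ≤ (β - α) * B) {x : ℝ} (hx : x ∈ Set.Icc α β) : ‖v x‖ ≤ 2 * √(A * B) := by
  -- The length at which the average of |v|, at most A/√ℓ, and the oscillation of v, at most √ℓ B,
  -- are both bounded by √(AB).
  set ℓ := A / B with hℓ
  have hℓ0 : 0 < ℓ := by positivity
  have hℓle : ℓ ≤ β - α := by rwa [hℓ, div_le_iff₀ hB]
  -- [c, c + ℓ] contains x and stays inside [α, β], also when x is close to an end.
  set c := max α (x - ℓ)
  have hcα : α ≤ c := le_max_left _ _
  have hcx : c ≤ x := max_le hx.1 (by linarith)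
  have hxd : x ≤ c + ℓ := by linarith [le_max_right α (x - ℓ)]
  have hdβ : c + ℓ ≤ β := by
    rcases max_cases α (x - ℓ) with h' | h' <;> linarith [hx.2]
  have hcd : c ≤ c + ℓ := by linarith
  have hsub : Set.Ioc c (c + ℓ) ⊆ Set.Ioc α β := Set.Ioc_subset_Ioc hcα hdβ
  have hαβ : α ≤ β := by linarith
  have hmono {E : Type} [NormedAddCommGroup E] {f : ℝ → E} {T : ℝ}
      (hf : MemLp f 2 (volume.restrict (Set.Ioc α β))) (hT : ∫ x in α..β, ‖f x‖ ^ 2 ≤ T) :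
      ∫ x in c..c + ℓ, ‖f x‖ ^ 2 ≤ T := by
    refine le_trans ?_ hT
    rw [intervalIntegral.integral_of_le hcd, intervalIntegral.integral_of_le hαβ]
    exact setIntegral_mono_set hf.norm.integrable_sq (.of_forall fun x ↦ by positivity)
      hsub.eventuallyLE
  have hrestr {E : Type} [NormedAddCommGroup E] {f : ℝ → E}
      (hf : MemLp f 2 (volume.restrict (Set.Ioc α β))) :
      MemLp f 2 (volume.restrict (Set.Ioc c (c + ℓ))) :=
    hf.mono_measure (Measure.restrict_mono hsub le_rfl)
  have hv2 := h.continuous.memLp_restrict_Ioc 2 α β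
  have h1 : MemLp (fun _ : ℝ ↦ (1 : ℝ)) 2 (volume.restrict (Set.Ioc c (c + ℓ))) :=
    continuous_const.memLp_restrict_Ioc 2 _ _
  have h1i : ∫ _ in c..c + ℓ, ‖(1 : ℝ)‖ ^ 2 ≤ √ℓ ^ 2 := by
    simp [Real.sq_sqrt hℓ0.le]
  have hgi : ∫ y in c..c + ℓ, ‖g y‖ ≤ √ℓ * B := by
    simpa using intervalIntegral_norm_mul_norm_le hcd h1 (hrestr hg) (Real.sqrt_nonneg ℓ) hB.le
      h1i (hmono hg hgB)
  have hvi : ∫ y in c..c + ℓ, ‖v y‖ ≤ √ℓ * A := by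
    simpa using intervalIntegral_norm_mul_norm_le hcd h1 (hrestr hv2) (Real.sqrt_nonneg ℓ) hA.le
      h1i (hmono hv2 hvA)
  have hpt : ∀ y ∈ Set.Icc c (c + ℓ), ‖v x‖ ≤ ‖v y‖ + √ℓ * B := by
    intro y hy
    have h2 : ‖v x - v y‖ ≤ √ℓ * B := by
      rw [h.sub_eq y x]
      refine le_trans ?_ hgi
      rw [intervalIntegral.integral_of_le hcd]
      refine intervalIntegral.norm_integral_le_integral_norm_uIoc.trans ?_
      refine setIntegral_mono_set
        ((intervalIntegrable_iff_integrableOn_Ioc_of_le hcd).1 (h.intervalIntegrable _ _)).norm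
        (.of_forall fun x ↦ norm_nonneg _) (LE.le.eventuallyLE ?_)
      rw [← Set.uIoc_of_le hcd]
      exact Set.uIoc_subset_uIoc_of_uIcc_subset_uIcc (Set.uIcc_subset_uIcc
        (by rwa [Set.uIcc_of_le hcd]) (by rw [Set.uIcc_of_le hcd]; exact ⟨hcx, hxd⟩))
    have h3 : ‖v x‖ ≤ ‖v y‖ + ‖v x - v y‖ := by
      simpa using norm_add_le (v y) (v x - v y)
    linarith
  have hint : ℓ * ‖v x‖ ≤ √ℓ * A + ℓ * (√ℓ * B) := by
    have := intervalIntegral.integral_mono_on (μ := volume) hcd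
      ((continuous_const (y := ‖v x‖)).intervalIntegrable _ _)
      ((h.continuous.norm.fun_add continuous_const).intervalIntegrable _ _) hpt
    rw [intervalIntegral.integral_const, intervalIntegral.integral_add
      (h.continuous.norm.intervalIntegrable _ _) (continuous_const.intervalIntegrable _ _),
      intervalIntegral.integral_const, add_sub_cancel_left, smul_eq_mul, smul_eq_mul] at this
    linarith
  have hsA := Real.mul_self_sqrt hA.le
  have hsB := Real.mul_self_sqrt hB.le
  have hA0 : 0 < √A := Real.sqrt_pos.2 hA
  have hB0 : 0 < √B := Real.sqrt_pos.2 hB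
  rw [hℓ, Real.sqrt_div hA.le, ← hsA, ← hsB, Real.sqrt_mul_self hA0.le,
    Real.sqrt_mul_self hB0.le] at hint
  rw [Real.sqrt_mul hA.le]
  have h5 : √A / √B * (√A * √A) + √A * √A / (√B * √B) * (√A / √B * (√B * √B)) =
      √A * √A / (√B * √B) * (2 * (√A * √B)) := by
    field_simp
    ring
  rw [h5] at hint
  exact le_of_mul_le_mul_left hint (by positivity)

/-! ### Oscillatory integrals with an amplitude whose derivative is in L². -/

section Oscillatory

variable {Φ : ℝ → ℝ} {α β τ Λ : ℝ}

/-- The integrand is the derivative of arctan(τΦ')/τ, whose total variation range is at most π/τ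
whatever the interval. -/
theorem integral_deriv_deriv_mul_inv_le (hΦ : ContDiff ℝ 2 Φ) (hτ : 0 < τ) :
    ∫ x in α..β, deriv (deriv Φ) x * (1 + (τ * deriv Φ x) ^ 2)⁻¹ ≤ Real.pi / τ := by
  have h1 : ContDiff ℝ 1 (deriv Φ) := hΦ.deriv'
  have hc : Continuous (deriv (deriv Φ)) := h1.continuous_deriv le_rfl
  have hd (x : ℝ) : HasDerivAt (fun x ↦ Real.arctan (τ * deriv Φ x) / τ)
      (deriv (deriv Φ) x * (1 + (τ * deriv Φ x) ^ 2)⁻¹) x := by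
    convert! ((((h1.differentiable one_ne_zero x).hasDerivAt.const_mul τ).arctan).div_const τ)
      using 1
    field_simp
  rw [intervalIntegral.integral_eq_sub_of_hasDerivAt (fun x _ ↦ hd x)
    (Continuous.intervalIntegrable (hc.mul (Continuous.inv₀ (by fun_prop) fun x ↦ by positivity))
      _ _), ← sub_div]
  gcongr
  linarith [Real.arctan_lt_pi_div_two (τ * deriv Φ β), Real.neg_pi_div_two_lt_arctan (τ * deriv Φ α)]

theorem integral_inv_le (hΦ : ContDiff ℝ 2 Φ) (hαβ : α ≤ β) (hτ : 0 < τ) (hΛ : 0 < Λ)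
    (h : ∀ x ∈ Set.Icc α β, Λ ≤ deriv (deriv Φ) x) :
    ∫ x in α..β, (1 + (τ * deriv Φ x) ^ 2)⁻¹ ≤ Real.pi / (τ * Λ) := by
  have h1 : ContDiff ℝ 1 (deriv Φ) := hΦ.deriv'
  have hc : Continuous (deriv (deriv Φ)) := h1.continuous_deriv le_rfl
  have hi : Continuous fun x ↦ (1 + (τ * deriv Φ x) ^ 2)⁻¹ :=
    Continuous.inv₀ (by fun_prop) fun x ↦ by positivity
  rw [← div_div, le_div_iff₀ hΛ, ← intervalIntegral.integral_mul_const]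
  refine le_trans (intervalIntegral.integral_mono_on hαβ
    ((hi.mul continuous_const).intervalIntegrable _ _) ((hc.mul hi).intervalIntegrable _ _)
    fun x hx ↦ ?_) (integral_deriv_deriv_mul_inv_le hΦ hτ)
  rw [mul_comm]
  exact mul_le_mul_of_nonneg_right (h x hx) (by positivity)

/-- The function τ²Φ'/(1 + (τΦ')²) replaces 1/Φ' in the integration by parts. It agrees with 1/Φ' up
to small relative error where τ|Φ'| is large and stays bounded at the stationary point, so no
neighbourhood of that point has to be cut out. -/
theorem hasDerivAt_resolvent (hΦ : ContDiff ℝ 2 Φ) (τ x : ℝ) :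
    HasDerivAt (fun x ↦ τ ^ 2 * deriv Φ x / (1 + (τ * deriv Φ x) ^ 2))
      (τ ^ 2 * deriv (deriv Φ) x * (1 - (τ * deriv Φ x) ^ 2) / (1 + (τ * deriv Φ x) ^ 2) ^ 2)
      x := by
  have h1 : ContDiff ℝ 1 (deriv Φ) := hΦ.deriv'
  have hd := (h1.differentiable one_ne_zero x).hasDerivAt
  convert! (hd.const_mul (τ ^ 2)).div (((hd.const_mul τ).fun_pow 2).const_add 1) (by positivity) using 1
  push_cast
  ring

theorem abs_resolvent_le (hτ : 0 ≤ τ) (y : ℝ) : |τ ^ 2 * y / (1 + (τ * y) ^ 2)| ≤ τ / 2 := by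
  rw [abs_div, abs_of_pos (by positivity : (0 : ℝ) < 1 + (τ * y) ^ 2), div_le_iff₀ (by positivity),
    abs_mul, abs_of_nonneg (by positivity : 0 ≤ τ ^ 2)]
  have : 0 ≤ τ * (1 - τ * |y|) ^ 2 := by positivity
  rw [mul_pow, ← sq_abs y]
  nlinarith

theorem resolvent_sq_le (τ y : ℝ) :
    (τ ^ 2 * y / (1 + (τ * y) ^ 2)) ^ 2 ≤ τ ^ 2 * (1 + (τ * y) ^ 2)⁻¹ := by
  rw [div_pow, ← div_eq_mul_inv, div_le_div_iff₀ (by positivity) (by positivity)]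
  have : 0 ≤ τ ^ 2 * (1 + (τ * y) ^ 2) := by positivity
  nlinarith

theorem abs_deriv_resolvent_le (τ y : ℝ) {z : ℝ} (hz : 0 ≤ z) :
    |τ ^ 2 * z * (1 - (τ * y) ^ 2) / (1 + (τ * y) ^ 2) ^ 2| ≤
      τ ^ 2 * (z * (1 + (τ * y) ^ 2)⁻¹) := by
  have h1 : |1 - (τ * y) ^ 2| ≤ 1 + (τ * y) ^ 2 := by
    rw [abs_le]
    constructor <;> nlinarith [sq_nonneg (τ * y)]
  rw [abs_div, abs_mul, abs_of_nonneg (by positivity : 0 ≤ τ ^ 2 * z),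
    abs_of_pos (by positivity : 0 < (1 + (τ * y) ^ 2) ^ 2), div_le_iff₀ (by positivity)]
  calc τ ^ 2 * z * |1 - (τ * y) ^ 2| ≤ τ ^ 2 * z * (1 + (τ * y) ^ 2) := by gcongr
    _ = _ := by field_simp

variable {v g m : ℝ → ℂ} {A B M W ℓ : ℝ}

/-- Integration by parts in an oscillatory integral at the scale `τ`. -/
theorem IsPrimitive.norm_integral_oscillatory_le_add (hv : IsPrimitive v g) (hΦ : ContDiff ℝ 2 Φ)
    (hm : ContDiff ℝ 1 m) (hαβ : α ≤ β) (hτ : 0 < τ) (hΛ : 0 < Λ)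
    (h : ∀ x ∈ Set.Icc α β, Λ ≤ deriv (deriv Φ) x)
    (hg : MemLp g 2 (volume.restrict (Set.Ioc α β))) (hA : 0 ≤ A) (hB : 0 ≤ B)
    (hvA : ∫ x in α..β, ‖v x‖ ^ 2 ≤ A ^ 2) (hgB : ∫ x in α..β, ‖g x‖ ^ 2 ≤ B ^ 2)
    (hvM : ∀ x ∈ Set.Icc α β, ‖v x‖ ≤ M) (hℓ : 0 < ℓ) (hAB : A ≤ ℓ * B)
    (hmW : ∀ x ∈ Set.Icc α β, ‖m x‖ ≤ W) (hmW' : ∀ x ∈ Set.Icc α β, ‖deriv m x‖ ≤ W / ℓ) :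
    ‖∫ x in α..β, m x * Complex.exp (-(Φ x * Complex.I)) * v x‖ ≤
      W * (∫ x in α..β, ‖(1 + (τ * deriv Φ x) ^ 2)⁻¹‖ * ‖v x‖) +
        W * τ * ((1 + Real.pi) * M + 2 * √(Real.pi / (τ * Λ)) * B) := by
  have h1 : ContDiff ℝ 1 (deriv Φ) := hΦ.deriv'
  have hΦc := h1.continuous
  have hc : Continuous (deriv (deriv Φ)) := h1.continuous_deriv le_rfl
  have hR : Continuous fun x ↦ (1 + (τ * deriv Φ x) ^ 2)⁻¹ :=
    Continuous.inv₀ (by fun_prop) fun x ↦ by positivity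
  have hvc := hv.continuous
  have hmc := hm.continuous
  have hmc' := hm.continuous_deriv le_rfl
  have hΦ0 : Continuous Φ := hΦ.continuous
  -- The splitting is 1 = (1 + (τΦ')²)⁻¹ + qΦ'. The first term is concentrated near the stationary
  -- point; in the second, Φ' is a derivative of the exponential.
  set q : ℝ → ℝ := fun x ↦ τ ^ 2 * deriv Φ x / (1 + (τ * deriv Φ x) ^ 2) with hq
  set q' : ℝ → ℝ := fun x ↦
    τ ^ 2 * deriv (deriv Φ) x * (1 - (τ * deriv Φ x) ^ 2) / (1 + (τ * deriv Φ x) ^ 2) ^ 2 with hq'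
  have hqd (x : ℝ) : HasDerivAt q (q' x) x := hasDerivAt_resolvent hΦ τ x
  have hqc' : Continuous q' := Continuous.div₀ (by fun_prop) (by fun_prop) fun x ↦ by positivity
  have hqc : Continuous q := Continuous.div₀ (by fun_prop) (by fun_prop) fun x ↦ by positivity
  set e : ℝ → ℂ := fun x ↦ Complex.exp (-(Φ x * Complex.I)) with he
  have hec : Continuous e := by fun_prop
  have hen (x : ℝ) : ‖e x‖ = 1 := by
    have : -(Φ x * Complex.I) = ((-Φ x : ℝ) : ℂ) * Complex.I := by push_cast; ring
    change ‖Complex.exp (-(Φ x * Complex.I))‖ = 1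
    rw [this, Complex.norm_exp_ofReal_mul_I]
  have hed (x : ℝ) : HasDerivAt e (-(deriv Φ x * Complex.I) * e x) x := by
    convert! (((hΦ.differentiable two_ne_zero x).hasDerivAt.ofReal_comp.mul_const
      Complex.I).fun_neg).cexp using 1
    ring
  have hM : 0 ≤ M := (norm_nonneg _).trans (hvM α ⟨le_rfl, hαβ⟩)
  have hW : 0 ≤ W := (norm_nonneg _).trans (hmW α ⟨le_rfl, hαβ⟩)
  set ρ : ℝ → ℂ := fun x ↦ Complex.I * q x * m x * e x with hρ
  have hρd (x : ℝ) : HasDerivAt ρ (Complex.I * q' x * m x * e x + Complex.I * q x * deriv m x * e x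
      + q x * deriv Φ x * m x * e x) x := by
    convert! ((((hqd x).ofReal_comp.const_mul Complex.I).fun_mul
      (hm.differentiable one_ne_zero x).hasDerivAt).mul (hed x)) using 1
    linear_combination (q x * (deriv Φ x : ℝ) * m x * e x) * Complex.I_sq
  have hρ' : deriv ρ = fun x ↦ Complex.I * q' x * m x * e x + Complex.I * q x * deriv m x * e x
      + q x * deriv Φ x * m x * e x := funext fun x ↦ (hρd x).deriv
  have hρc : ContDiff ℝ 1 ρ := by
    rw [contDiff_one_iff_deriv, hρ']
    exact ⟨fun x ↦ (hρd x).differentiableAt, by fun_prop⟩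
  have hparts := hv.integral_mul_eq hρc α β
  have hsplit : ∫ x in α..β, m x * e x * v x =
      (∫ x in α..β, m x * ((1 + (τ * deriv Φ x) ^ 2)⁻¹ : ℝ) * e x * v x) +
        (ρ β * v β - ρ α * v α - (∫ x in α..β, ρ x * g x) -
          (∫ x in α..β, Complex.I * q' x * m x * e x * v x) -
          ∫ x in α..β, Complex.I * q x * deriv m x * e x * v x) := by
    rw [hparts, hρ']
    have i1 : Continuous fun x ↦ m x * ((1 + (τ * deriv Φ x) ^ 2)⁻¹ : ℝ) * e x * v x := by fun_prop
    have i2 : Continuous fun x ↦ Complex.I * q' x * m x * e x * v x := by fun_prop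
    have i3 : Continuous fun x ↦ Complex.I * q x * deriv m x * e x * v x := by fun_prop
    have i4 : Continuous fun x ↦ q x * deriv Φ x * m x * e x * v x := by fun_prop
    have e1 : ∫ x in α..β, (Complex.I * q' x * m x * e x + Complex.I * q x * deriv m x * e x
        + q x * deriv Φ x * m x * e x) * v x =
        (∫ x in α..β, Complex.I * q' x * m x * e x * v x) +
          (∫ x in α..β, Complex.I * q x * deriv m x * e x * v x) +
          ∫ x in α..β, q x * deriv Φ x * m x * e x * v x := by
      simp_rw [add_mul]
      rw [intervalIntegral.integral_add ((Continuous.fun_add i2 i3).intervalIntegrable _ _)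
        (i4.intervalIntegrable _ _), intervalIntegral.integral_add (i2.intervalIntegrable _ _)
        (i3.intervalIntegrable _ _)]
    have e2 : ∫ x in α..β, m x * e x * v x =
        (∫ x in α..β, m x * ((1 + (τ * deriv Φ x) ^ 2)⁻¹ : ℝ) * e x * v x) +
          ∫ x in α..β, q x * deriv Φ x * m x * e x * v x := by
      rw [← intervalIntegral.integral_add (i1.intervalIntegrable _ _) (i4.intervalIntegrable _ _)]
      congr 1
      funext x
      have hne : (1 : ℝ) + (τ * deriv Φ x) ^ 2 ≠ 0 := by positivity
      have : (((1 + (τ * deriv Φ x) ^ 2)⁻¹ : ℝ) : ℂ) + q x * deriv Φ x = 1 := by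
        rw [← Complex.ofReal_mul, ← Complex.ofReal_add, hq]
        norm_cast
        field_simp
      linear_combination (-(m x * e x * v x)) * this
    rw [e1, e2]
    ring
  -- The L² norm of q is what allows g to be only in L².
  have hqL : ∫ x in α..β, ‖q x‖ ^ 2 ≤ (τ * √(Real.pi / (τ * Λ))) ^ 2 := by
    rw [mul_pow, Real.sq_sqrt (by positivity)]
    calc ∫ x in α..β, ‖q x‖ ^ 2 ≤ ∫ x in α..β, τ ^ 2 * (1 + (τ * deriv Φ x) ^ 2)⁻¹ := by
          refine intervalIntegral.integral_mono_on hαβ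
            ((hqc.norm.pow 2).intervalIntegrable _ _)
            ((continuous_const.mul hR).intervalIntegrable _ _) fun x _ ↦ ?_
          rw [Real.norm_eq_abs, sq_abs]
          exact resolvent_sq_le τ _
      _ ≤ _ := by
          rw [intervalIntegral.integral_const_mul]
          gcongr
          exact integral_inv_le hΦ hαβ hτ hΛ h
  have hq2 := hqc.memLp_restrict_Ioc 2 α β
  have hv2 := hvc.memLp_restrict_Ioc 2 α β
  have b1 : ‖∫ x in α..β, m x * ((1 + (τ * deriv Φ x) ^ 2)⁻¹ : ℝ) * e x * v x‖ ≤
      W * ∫ x in α..β, ‖(1 + (τ * deriv Φ x) ^ 2)⁻¹‖ * ‖v x‖ := by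
    rw [← intervalIntegral.integral_const_mul]
    refine intervalIntegral.norm_integral_le_of_norm_le hαβ (.of_forall fun x hx ↦ ?_)
      ((continuous_const.mul (hR.norm.mul hvc.norm)).intervalIntegrable _ _)
    rw [norm_mul, norm_mul, norm_mul, hen, Complex.norm_real, mul_one, mul_assoc]
    gcongr
    exact hmW x (Set.Ioc_subset_Icc_self hx)
  have b2 : ‖∫ x in α..β, ρ x * g x‖ ≤ W * (τ * √(Real.pi / (τ * Λ)) * B) := by
    refine le_trans ?_ (mul_le_mul_of_nonneg_left (intervalIntegral_norm_mul_norm_le hαβ hq2 hg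
      (by positivity) hB hqL hgB) hW)
    rw [← intervalIntegral.integral_const_mul]
    refine intervalIntegral.norm_integral_le_of_norm_le hαβ (.of_forall fun x hx ↦ ?_)
      ((intervalIntegrable_norm_mul_norm hαβ hq2 hg).const_mul _)
    rw [hρ, norm_mul, norm_mul, norm_mul, norm_mul, hen, Complex.norm_real, mul_one,
      Complex.norm_I, one_mul]
    calc ‖q x‖ * ‖m x‖ * ‖g x‖ = ‖m x‖ * (‖q x‖ * ‖g x‖) := by ring
      _ ≤ _ := by
        gcongr
        exact hmW x (Set.Ioc_subset_Icc_self hx)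
  -- The derivative of the multiplier costs 1/ℓ, and A ≤ ℓB makes this no worse than the term with
  -- g.
  have b3 : ‖∫ x in α..β, Complex.I * q x * deriv m x * e x * v x‖ ≤
      W * (τ * √(Real.pi / (τ * Λ)) * B) := by
    have : W / ℓ * (τ * √(Real.pi / (τ * Λ)) * A) ≤ W * (τ * √(Real.pi / (τ * Λ)) * B) := by
      rw [div_mul_eq_mul_div, div_le_iff₀ hℓ]
      calc W * (τ * √(Real.pi / (τ * Λ)) * A) ≤ W * (τ * √(Real.pi / (τ * Λ)) * (ℓ * B)) := by
            gcongr
        _ = _ := by ring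
    refine le_trans ?_ this
    refine le_trans ?_ (mul_le_mul_of_nonneg_left (intervalIntegral_norm_mul_norm_le hαβ hq2 hv2
      (by positivity) hA hqL hvA) (by positivity))
    rw [← intervalIntegral.integral_const_mul]
    refine intervalIntegral.norm_integral_le_of_norm_le hαβ (.of_forall fun x hx ↦ ?_)
      ((intervalIntegrable_norm_mul_norm hαβ hq2 hv2).const_mul _)
    rw [norm_mul, norm_mul, norm_mul, norm_mul, hen, Complex.norm_real, mul_one,
      Complex.norm_I, one_mul]
    calc ‖q x‖ * ‖deriv m x‖ * ‖v x‖ = ‖deriv m x‖ * (‖q x‖ * ‖v x‖) := by ring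
      _ ≤ _ := by
        gcongr
        exact hmW' x (Set.Ioc_subset_Icc_self hx)
  -- Convexity gives |q'| ≤ τ²Φ''/(1 + (τΦ')²), with integral at most πτ; no upper bound on Φ'' is
  -- needed.
  have b4 : ‖∫ x in α..β, Complex.I * q' x * m x * e x * v x‖ ≤ W * (τ * (Real.pi * M)) := by
    have : ∫ x in α..β, W * M * τ ^ 2 * (deriv (deriv Φ) x * (1 + (τ * deriv Φ x) ^ 2)⁻¹) ≤
        W * (τ * (Real.pi * M)) := by
      rw [intervalIntegral.integral_const_mul]
      calc _ ≤ W * M * τ ^ 2 * (Real.pi / τ) := by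
            gcongr
            exact integral_deriv_deriv_mul_inv_le hΦ hτ
        _ = _ := by field_simp
    refine le_trans ?_ this
    refine intervalIntegral.norm_integral_le_of_norm_le hαβ (.of_forall fun x hx ↦ ?_)
      ((continuous_const.mul (hc.mul hR)).intervalIntegrable _ _)
    have hx' := Set.Ioc_subset_Icc_self hx
    rw [norm_mul, norm_mul, norm_mul, norm_mul, hen, Complex.norm_real, mul_one,
      Complex.norm_I, one_mul]
    calc ‖q' x‖ * ‖m x‖ * ‖v x‖ ≤
          (τ ^ 2 * (deriv (deriv Φ) x * (1 + (τ * deriv Φ x) ^ 2)⁻¹)) * W * M := by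
          gcongr
          · exact mul_nonneg (mul_nonneg (sq_nonneg _)
              (mul_nonneg (hΛ.le.trans (h x hx')) (by positivity))) hW
          · exact mul_nonneg (sq_nonneg _)
              (mul_nonneg (hΛ.le.trans (h x hx')) (by positivity))
          · exact abs_deriv_resolvent_le τ _ (hΛ.le.trans (h x hx'))
          · exact hmW x hx'
          · exact hvM x hx'
      _ = _ := by ring
  have b5 {x : ℝ} (hx : x ∈ Set.Icc α β) : ‖ρ x * v x‖ ≤ W * (τ / 2 * M) := by
    rw [hρ, norm_mul, norm_mul, norm_mul, norm_mul, hen, Complex.norm_real, mul_one,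
      Complex.norm_I, one_mul]
    calc ‖q x‖ * ‖m x‖ * ‖v x‖ ≤ τ / 2 * W * M := by
          gcongr
          · exact abs_resolvent_le hτ.le _
          · exact hmW x hx
          · exact hvM x hx
      _ = _ := by ring
  have c1 := b5 (Set.left_mem_Icc.2 hαβ)
  have c2 := b5 (Set.right_mem_Icc.2 hαβ)
  rw [hsplit]
  refine (norm_add_le _ _).trans ?_
  have n1 := norm_sub_le (ρ β * v β - ρ α * v α - (∫ x in α..β, ρ x * g x) -
          (∫ x in α..β, Complex.I * q' x * m x * e x * v x))
          (∫ x in α..β, Complex.I * q x * deriv m x * e x * v x)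
  have n2 := norm_sub_le (ρ β * v β - ρ α * v α - (∫ x in α..β, ρ x * g x))
          (∫ x in α..β, Complex.I * q' x * m x * e x * v x)
  have n3 := norm_sub_le (ρ β * v β - ρ α * v α) (∫ x in α..β, ρ x * g x)
  have n4 := norm_sub_le (ρ β * v β) (ρ α * v α)
  linarith

/-- The scale is τ = min(Λ^{-1/2}, A/B): the first is the usual stationary phase width, the second
takes over when v varies faster than that width permits. -/
theorem IsPrimitive.norm_integral_oscillatory_le (hv : IsPrimitive v g) (hΦ : ContDiff ℝ 2 Φ)
    (hm : ContDiff ℝ 1 m) (hΛ : 0 < Λ) (h : ∀ x ∈ Set.Icc α β, Λ ≤ deriv (deriv Φ) x)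
    (hg : MemLp g 2 (volume.restrict (Set.Ioc α β))) (hA : 0 < A) (hB : 0 < B)
    (hvA : ∫ x in α..β, ‖v x‖ ^ 2 ≤ A ^ 2) (hgB : ∫ x in α..β, ‖g x‖ ^ 2 ≤ B ^ 2)
    (hℓ : 0 < ℓ) (hAB : A ≤ ℓ * B) (hℓle : ℓ ≤ β - α)
    (hmW : ∀ x ∈ Set.Icc α β, ‖m x‖ ≤ W) (hmW' : ∀ x ∈ Set.Icc α β, ‖deriv m x‖ ≤ W / ℓ) :
    ‖∫ x in α..β, m x * Complex.exp (-(Φ x * Complex.I)) * v x‖ ≤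
      20 * W * (√(A * B) / √Λ) := by
  have hαβ : α ≤ β := by linarith
  have hW : 0 ≤ W := (norm_nonneg _).trans (hmW α ⟨le_rfl, hαβ⟩)
  have hvM : ∀ x ∈ Set.Icc α β, ‖v x‖ ≤ 2 * √(A * B) := fun x hx ↦
    hv.norm_le hg hA hB hvA hgB (hAB.trans (by gcongr)) hx
  have key (τ : ℝ) (hτ : 0 < τ) := hv.norm_integral_oscillatory_le_add hΦ hm hαβ hτ hΛ h hg hA.le
    hB.le hvA hgB hvM hℓ hAB hmW hmW'
  have hR (τ : ℝ) : Continuous fun x ↦ (1 + (τ * deriv Φ x) ^ 2)⁻¹ :=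
    Continuous.inv₀ (by have := (hΦ.deriv' (n := 1)).continuous; fun_prop) fun x ↦ by positivity
  set S := √(A * B) with hS
  set L := √Λ with hL
  have hL0 : 0 < L := Real.sqrt_pos.2 hΛ
  have hS0 : 0 < S := Real.sqrt_pos.2 (by positivity)
  have hSS : S ^ 2 = A * B := Real.sq_sqrt (by positivity)
  have hLL : L ^ 2 = Λ := Real.sq_sqrt hΛ.le
  have hpi := Real.pi_lt_d2
  have hpi0 := Real.pi_pos
  -- If B ≤ A√Λ, take τ = Λ^{-1/2} and use the sup bound of v near the stationary point. Otherwise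
  -- take τ = A/B and use Cauchy-Schwarz with the L² norm of v there.
  rcases le_total B (A * L) with hBA | hBA
  · have hX : ∫ x in α..β, ‖(1 + (L⁻¹ * deriv Φ x) ^ 2)⁻¹‖ * ‖v x‖ ≤
        2 * S * (Real.pi / (L⁻¹ * Λ)) := by
      refine le_trans ?_ (mul_le_mul_of_nonneg_left
        (integral_inv_le hΦ hαβ (inv_pos.2 hL0) hΛ h) (by positivity))
      rw [← intervalIntegral.integral_const_mul]
      refine intervalIntegral.integral_mono_on hαβ
        (((hR _).norm.mul hv.continuous.norm).intervalIntegrable _ _)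
        ((continuous_const.mul (hR _)).intervalIntegrable _ _) fun x hx ↦ ?_
      rw [Real.norm_of_nonneg (by positivity), mul_comm]
      exact mul_le_mul_of_nonneg_right (hvM x hx) (by positivity)
    have h1 : L⁻¹ * Λ = L := by rw [← hLL]; field_simp
    have hD : √(Real.pi / (L⁻¹ * Λ)) * B ≤ 2 * S := by
      rw [h1]
      refine abs_le_of_sq_le_sq' ?_ (by positivity) |>.2
      rw [mul_pow, mul_pow, Real.sq_sqrt (by positivity), hSS, div_mul_eq_mul_div,
        div_le_iff₀ hL0]
      have : B * B ≤ B * (A * L) := by gcongr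
      nlinarith
    refine (key L⁻¹ (by positivity)).trans ?_
    calc _ ≤ W * (2 * S * (Real.pi / L)) + W * L⁻¹ * ((1 + Real.pi) * (2 * S) + 2 * (2 * S)) := by
          rw [h1] at hX
          rw [mul_assoc 2 (√_) B]
          gcongr
        _ = W * (S / L) * (4 * Real.pi + 6) := by field_simp; ring
        _ ≤ W * (S / L) * 20 := by gcongr; linarith
        _ = _ := by ring
  · set D := √(Real.pi / (A / B * Λ)) with hD
    have hAD : A * D ≤ 2 * (S / L) := by
      refine abs_le_of_sq_le_sq' ?_ (by positivity) |>.2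
      rw [mul_pow, mul_pow, div_pow, hSS, hLL, Real.sq_sqrt (by positivity)]
      have : A ^ 2 * (Real.pi / (A / B * Λ)) = Real.pi * (A * B / Λ) := by field_simp
      rw [this]
      gcongr
      linarith
    have hX : ∫ x in α..β, ‖(1 + (A / B * deriv Φ x) ^ 2)⁻¹‖ * ‖v x‖ ≤ D * A := by
      refine intervalIntegral_norm_mul_norm_le hαβ ((hR _).memLp_restrict_Ioc 2 _ _)
        (hv.continuous.memLp_restrict_Ioc 2 _ _) (Real.sqrt_nonneg _) hA.le ?_ hvA
      rw [Real.sq_sqrt (by positivity)]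
      refine le_trans ?_ (integral_inv_le hΦ hαβ (by positivity) hΛ h)
      refine intervalIntegral.integral_mono_on hαβ
        (((hR _).norm.pow 2).intervalIntegrable _ _) ((hR _).intervalIntegrable _ _) fun x hx ↦ ?_
      rw [Real.norm_of_nonneg (by positivity)]
      refine pow_le_of_le_one (by positivity) (inv_le_one_of_one_le₀ ?_) two_ne_zero
      nlinarith [sq_nonneg (A / B * deriv Φ x)]
    have hτ : A / B ≤ L⁻¹ := by
      rw [div_le_iff₀ hB, ← div_eq_inv_mul, le_div_iff₀ hL0]
      exact hBA
    refine (key (A / B) (by positivity)).trans ?_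
    calc _ ≤ W * (D * A) + (W * (A / B) * ((1 + Real.pi) * (2 * S)) + W * (2 * (A * D))) := by
          have : W * (A / B) * ((1 + Real.pi) * (2 * S) + 2 * D * B) =
            W * (A / B) * ((1 + Real.pi) * (2 * S)) + W * (2 * (A * D)) := by field_simp
          rw [this]
          gcongr
        _ ≤ W * (2 * (S / L)) + (W * L⁻¹ * ((1 + Real.pi) * (2 * S)) + W * (2 * (2 * (S / L)))) := by
          rw [mul_comm D A]
          gcongr
        _ = W * (S / L) * (2 * Real.pi + 8) := by field_simp; ring
        _ ≤ W * (S / L) * 20 := by gcongr; linarith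
        _ = _ := by ring

end Oscillatory

/-! ### Weighted L² bounds and the estimate on one dyadic block. -/

theorem integral_norm_sq_le_of_eLpNorm_le {E X : Type*} [NormedAddCommGroup E] [MeasurableSpace X]
    {μ : Measure X} {f : X → E} {N : ℝ} (hf : MemLp f 2 μ) (hN : 0 ≤ N)
    (h : eLpNorm f 2 μ ≤ ENNReal.ofReal N) : ∫ x, ‖f x‖ ^ 2 ∂μ ≤ N ^ 2 := by
  rw [hf.eLpNorm_eq_integral_rpow_norm two_ne_zero ENNReal.ofNat_ne_top,
    ENNReal.ofReal_le_ofReal_iff hN] at h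
  simp only [ENNReal.toReal_ofNat, Real.rpow_two, ← one_div, ← Real.sqrt_eq_rpow] at h
  exact (Real.sqrt_le_left hN).1 h

theorem eLpNorm_le_of_integral_norm_sq_le {E X : Type*} [NormedAddCommGroup E] [MeasurableSpace X]
    {μ : Measure X} {f : X → E} {N : ℝ} (hf : MemLp f 2 μ) (hN : 0 ≤ N)
    (h : ∫ x, ‖f x‖ ^ 2 ∂μ ≤ N ^ 2) : eLpNorm f 2 μ ≤ ENNReal.ofReal N := by
  rw [hf.eLpNorm_eq_integral_rpow_norm two_ne_zero ENNReal.ofNat_ne_top,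
    ENNReal.ofReal_le_ofReal_iff hN]
  simp only [ENNReal.toReal_ofNat, Real.rpow_two, ← one_div, ← Real.sqrt_eq_rpow]
  exact (Real.sqrt_le_left hN).2 h

theorem memLp_Ioc_of_weight {f : ℝ → ℂ} {w : ℝ → ℝ} {α β c : ℝ}
    (hf : AEStronglyMeasurable f) (hwf : MemLp (fun x ↦ (w x : ℂ) * f x) 2)
    (hc : 0 < c) (hw : ∀ x ∈ Set.Icc α β, c ≤ w x) :
    MemLp f 2 (volume.restrict (Set.Ioc α β)) := by
  refine (hwf.restrict (Set.Ioc α β)).of_le_mul (c := c⁻¹) hf.restrict ?_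
  refine (ae_restrict_iff' measurableSet_Ioc).2 (.of_forall fun x hx ↦ ?_)
  have := hw x (Set.Ioc_subset_Icc_self hx)
  rw [norm_mul, Complex.norm_real, Real.norm_of_nonneg (hc.le.trans this), ← mul_assoc]
  refine le_mul_of_one_le_left (norm_nonneg _) ?_
  rwa [← div_eq_inv_mul, one_le_div hc]

theorem integral_Ioc_norm_sq_le_of_weight {f : ℝ → ℂ} {w : ℝ → ℝ} {α β c N : ℝ} (hαβ : α ≤ β)
    (hf : AEStronglyMeasurable f) (hwf : MemLp (fun x ↦ (w x : ℂ) * f x) 2) (hN : 0 ≤ N)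
    (h : eLpNorm (fun x ↦ (w x : ℂ) * f x) 2 ≤ ENNReal.ofReal N)
    (hc : 0 < c) (hw : ∀ x ∈ Set.Icc α β, c ≤ w x) :
    ∫ x in α..β, ‖f x‖ ^ 2 ≤ (N / c) ^ 2 := by
  have hm := memLp_Ioc_of_weight hf hwf hc hw
  rw [intervalIntegral.integral_of_le hαβ, div_pow, le_div_iff₀ (by positivity),
    ← integral_mul_const]
  refine le_trans ?_ (integral_norm_sq_le_of_eLpNorm_le hwf hN h)
  refine le_trans ?_ (setIntegral_le_integral (s := Set.Ioc α β) hwf.norm.integrable_sq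
    (.of_forall fun x ↦ by positivity))
  refine setIntegral_mono_on (hm.norm.integrable_sq.mul_const _)
    hwf.norm.integrable_sq.integrableOn measurableSet_Ioc fun x hx ↦ ?_
  have := hw x (Set.Ioc_subset_Icc_self hx)
  rw [norm_mul, Complex.norm_real, Real.norm_of_nonneg (hc.le.trans this), mul_pow, mul_comm]
  gcongr

theorem hasDerivAt_weight (s η : ℝ) : HasDerivAt (fun η ↦ (weight s η : ℂ))
    ((2 * Real.pi * s * weight (s - 1) η *
      (2 * Real.pi * η / japanese (2 * Real.pi * η)) : ℝ) : ℂ) η := by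
  have h0 : HasDerivAt (fun η : ℝ ↦ 2 * Real.pi * η) (2 * Real.pi) η := by
    simpa using (hasDerivAt_id η).const_mul (2 * Real.pi)
  convert! ((hasDerivAt_japanese_rpow s (2 * Real.pi * η)).comp η h0).ofReal_comp using 2
  rw [weight]
  ring

theorem norm_deriv_weight_le (s η : ℝ) :
    ‖deriv (fun η ↦ (weight s η : ℂ)) η‖ ≤ 2 * Real.pi * |s| * weight (s - 1) η := by
  rw [(hasDerivAt_weight s η).deriv, Complex.norm_real, Real.norm_eq_abs, abs_mul, abs_mul, abs_mul,
    abs_of_pos (weight_pos _ _), abs_of_pos Real.two_pi_pos]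
  refine mul_le_of_le_one_right (by have := weight_pos (s - 1) η; positivity) ?_
  rw [abs_div, abs_of_pos (japanese_pos _)]
  exact div_le_one_of_le₀ (abs_le_japanese _) (japanese_pos _).le

namespace IsDispersionSymbol

variable {σ : ℝ} {a : ℝ → ℝ}

/-- The phase `t a(ξ) - x ξ` at `ξ = 2 π η`. -/
noncomputable def _root_.dispersivePhase (a : ℝ → ℝ) (t x η : ℝ) : ℝ :=
  t * a (2 * Real.pi * η) - 2 * Real.pi * x * η

theorem contDiff_dispersivePhase (ha : IsDispersionSymbol σ a) (t x : ℝ) :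
    ContDiff ℝ ∞ (dispersivePhase a t x) :=
  (contDiff_const.mul (ha.smooth.comp (contDiff_const.mul contDiff_id))).sub
    (contDiff_const.mul contDiff_id)

theorem deriv_deriv_dispersivePhase (ha : IsDispersionSymbol σ a) (t x : ℝ) :
    deriv (deriv (dispersivePhase a t x)) =
      fun η ↦ (2 * Real.pi) ^ 2 * t * deriv (deriv a) (2 * Real.pi * η) := by
  have h1 : deriv (dispersivePhase a t x) =
      fun η ↦ t * (2 * Real.pi * deriv a (2 * Real.pi * η)) - 2 * Real.pi * x := by
    funext η
    refine HasDerivAt.deriv ?_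
    convert! ((ha.hasDerivAt_scaled η).const_mul t).sub
      ((hasDerivAt_id η).const_mul (2 * Real.pi * x)) using 1
    ring
  rw [h1]
  funext η
  have h0 : HasDerivAt (fun η : ℝ ↦ 2 * Real.pi * η) (2 * Real.pi) η := by
    simpa using (hasDerivAt_id η).const_mul (2 * Real.pi)
  refine HasDerivAt.deriv ?_
  convert! ((((ha.hasDerivAt_deriv (2 * Real.pi * η)).comp η h0).const_mul (2 * Real.pi)).const_mul
    t).sub_const (2 * Real.pi * x) using 1
  ring

/-- The pointwise decay estimate at frequencies comparable to `lam`. -/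
theorem exists_norm_integral_le (ha : IsDispersionSymbol σ a) {s₀ s₁ : ℝ} (hs : s₁ ≤ s₀ + 1)
    (s : ℝ) : ∃ C : ℝ, 0 < C ∧ ∀ (t : ℝ) (u : 𝓢'(ℝ, ℂ)) (v g : ℝ → ℂ), 0 < t →
      IsProfile a s₀ s₁ t u v g → ∀ (N lam α β x : ℝ), 0 < N →
      normX a s₀ s₁ t u ≤ ENNReal.ofReal N → 1 ≤ lam → lam / 2 ≤ β - α →
      (∀ η ∈ Set.Icc α β, lam ≤ japanese (2 * Real.pi * η) ∧
        japanese (2 * Real.pi * η) ≤ 16 * lam) →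
      ‖∫ η in α..β, (weight s η : ℂ) * Complex.exp (-(dispersivePhase a t x η * Complex.I)) * v η‖ ≤
        C * (t ^ (-(1 / 2) : ℝ) * lam ^ (s - (s₀ + s₁ + σ) / 2) * N) := by
  obtain ⟨c, C, hc, -, hac⟩ := ha.exists_bounds
  set k : ℝ → ℝ := fun p ↦ (16 : ℝ) ^ |p| with hk
  have hk0 (p : ℝ) : 0 < k p := by positivity
  -- The first summand accounts for the size of g; the second enlarges B so that A ≤ (λ/2) B holds.
  set b := 2 * Real.pi * k s₁ + 2 * k s₀ with hb
  have hb0 : 0 < b := by have := hk0 s₁; have := hk0 s₀; positivity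
  -- Large enough for the weight itself and for its derivative at the length ℓ = λ/2.
  set w := k s + Real.pi * |s| * k (s - 1) with hw
  have hw0 : 0 < w := by have := hk0 s; have := hk0 (s - 1); positivity
  refine ⟨20 * w * (√(k s₀ * b) / √(c / k σ)), by have := hk0 s₀; have := hk0 σ; positivity, ?_⟩
  intro t u v g ht hp N lam α β x hN hNu hlam hlen hJ
  have hlam0 : 0 < lam := by linarith
  have hαβ : α ≤ β := by linarith
  have hup (p : ℝ) {η : ℝ} (hη : η ∈ Set.Icc α β) : weight p η ≤ k p * lam ^ p :=
    rpow_le_of_comparable (by norm_num) (japanese_pos _) hlam0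
      (by linarith [(hJ η hη).1, japanese_pos (2 * Real.pi * η)]) (hJ η hη).2 p
  have hlow (p : ℝ) {η : ℝ} (hη : η ∈ Set.Icc α β) : (k p)⁻¹ * lam ^ p ≤ weight p η :=
    le_rpow_of_comparable (by norm_num) (japanese_pos _) hlam0
      (by linarith [(hJ η hη).1, japanese_pos (2 * Real.pi * η)]) (hJ η hη).2 p
  have hlp (p : ℝ) : 0 < lam ^ p := Real.rpow_pos_of_pos hlam0 p
  have hkl (p : ℝ) : 0 < (k p)⁻¹ * lam ^ p := mul_pos (inv_pos.2 (hk0 p)) (hlp p)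
  have hvA : ∫ η in α..β, ‖v η‖ ^ 2 ≤ (k s₀ * lam ^ (-s₀) * N) ^ 2 := by
    refine (integral_Ioc_norm_sq_le_of_weight hαβ hp.primitive.continuous.aestronglyMeasurable
      hp.memLp hN.le (hp.eLpNorm_le.trans hNu) (hkl s₀) fun η hη ↦ hlow s₀ hη).trans_eq ?_
    rw [Real.rpow_neg hlam0.le]
    have := hk0 s₀
    have := hlp s₀
    congr 1
    field_simp
  have hgm := memLp_Ioc_of_weight hp.primitive.locallyIntegrable.aestronglyMeasurable
    hp.memLp_deriv (hkl s₁) fun η hη ↦ hlow s₁ hη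
  have hgB : ∫ η in α..β, ‖g η‖ ^ 2 ≤ (b * lam ^ (-s₁) * N) ^ 2 := by
    have h1 : eLpNorm (fun η ↦ (weight s₁ η : ℂ) * g η) 2 ≤ ENNReal.ofReal (2 * Real.pi * N) := by
      refine hp.eLpNorm_deriv_le.trans ?_
      rw [ENNReal.ofReal_mul Real.two_pi_pos.le]
      gcongr
    refine (integral_Ioc_norm_sq_le_of_weight hαβ
      hp.primitive.locallyIntegrable.aestronglyMeasurable
      hp.memLp_deriv (by positivity) h1 (hkl s₁) fun η hη ↦ hlow s₁ hη).trans ?_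
    have := hk0 s₁
    have := hlp s₁
    have h2 : 2 * Real.pi * N / ((k s₁)⁻¹ * lam ^ s₁) = 2 * Real.pi * k s₁ * lam ^ (-s₁) * N := by
      rw [Real.rpow_neg hlam0.le]
      field_simp
    have h3 : 2 * Real.pi * k s₁ ≤ b := by
      rw [hb]
      linarith [hk0 s₀]
    rw [h2]
    have := hlp (-s₁)
    gcongr
  have hAB : k s₀ * lam ^ (-s₀) * N ≤ lam / 2 * (b * lam ^ (-s₁) * N) := by
    have h1 : lam ^ (-s₀) ≤ lam ^ (1 - s₁) :=
      Real.rpow_le_rpow_of_exponent_le hlam (by linarith)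
    have h2 : lam * lam ^ (-s₁) = lam ^ (1 - s₁) := by
      rw [sub_eq_add_neg, Real.rpow_add hlam0, Real.rpow_one]
    have h3 : 2 * k s₀ ≤ b := by
      rw [hb]
      linarith [mul_pos Real.two_pi_pos (hk0 s₁)]
    calc k s₀ * lam ^ (-s₀) * N ≤ (b / 2) * lam ^ (1 - s₁) * N := by
          have := hlp (-s₀)
          gcongr
          linarith
      _ = _ := by
          rw [← h2]
          ring
  set Λ := t * (c * ((k σ)⁻¹ * lam ^ σ)) with hΛ
  have hΛ0 : 0 < Λ := mul_pos ht (mul_pos hc (hkl σ))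
  have hconv : ∀ η ∈ Set.Icc α β, Λ ≤ deriv (deriv (dispersivePhase a t x)) η := by
    intro η hη
    rw [ha.deriv_deriv_dispersivePhase]
    have h1 : c * ((k σ)⁻¹ * lam ^ σ) ≤ deriv (deriv a) (2 * Real.pi * η) :=
      (mul_le_mul_of_nonneg_left (hlow σ hη) hc.le).trans (hac _).1
    calc Λ ≤ t * deriv (deriv a) (2 * Real.pi * η) := by rw [hΛ]; gcongr
      _ ≤ (2 * Real.pi) ^ 2 * (t * deriv (deriv a) (2 * Real.pi * η)) := by
        refine le_mul_of_one_le_left (mul_pos ht (ha.deriv_deriv_pos _)).le ?_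
        nlinarith [Real.pi_gt_three]
      _ = _ := by ring
  have hWm : ∀ η ∈ Set.Icc α β, ‖(weight s η : ℂ)‖ ≤ w * lam ^ s := by
    intro η hη
    rw [Complex.norm_real, Real.norm_of_nonneg (weight_pos _ _).le]
    refine (hup s hη).trans ?_
    have := hlp s
    have := hk0 (s - 1)
    gcongr
    rw [hw]
    have : 0 ≤ Real.pi * |s| * k (s - 1) := by positivity
    linarith
  have hWm' : ∀ η ∈ Set.Icc α β,
      ‖deriv (fun η ↦ (weight s η : ℂ)) η‖ ≤ w * lam ^ s / (lam / 2) := by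
    intro η hη
    refine (norm_deriv_weight_le s η).trans ?_
    have h1 : w * lam ^ s / (lam / 2) = 2 * w * lam ^ (s - 1) := by
      rw [Real.rpow_sub_one hlam0.ne']
      field_simp
    rw [h1]
    have h2 := hup (s - 1) hη
    have h3 : Real.pi * |s| * k (s - 1) ≤ w := by
      rw [hw]
      linarith [hk0 s]
    calc 2 * Real.pi * |s| * weight (s - 1) η ≤ 2 * Real.pi * |s| * (k (s - 1) * lam ^ (s - 1)) := by
          gcongr
      _ = 2 * (Real.pi * |s| * k (s - 1)) * lam ^ (s - 1) := by ring
      _ ≤ _ := by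
          have := hlp (s - 1)
          gcongr
  have h1 : ContDiff ℝ 1 (fun η ↦ (weight s η : ℂ)) :=
    (hasTemperateGrowth_weight s).1.of_le (by simp)
  have main := hp.primitive.norm_integral_oscillatory_le
    (contDiff_infty.1 (ha.contDiff_dispersivePhase t x) 2) h1 hΛ0 hconv hgm
    (by have := hk0 s₀; have := hlp (-s₀); positivity) (by have := hlp (-s₁); positivity) hvA hgB
    (by linarith) hAB hlen hWm hWm'
  refine main.trans_eq ?_
  have e1 : k s₀ * lam ^ (-s₀) * N * (b * lam ^ (-s₁) * N) =
      k s₀ * b * (lam ^ (-(s₀ + s₁) / 2) * N) ^ 2 := by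
    have : lam ^ (-s₀) * lam ^ (-s₁) = lam ^ (-(s₀ + s₁) / 2) * lam ^ (-(s₀ + s₁) / 2) := by
      rw [← Real.rpow_add hlam0, ← Real.rpow_add hlam0]
      congr 1
      ring
    linear_combination (k s₀ * b * N ^ 2) * this
  have e2 : Λ = c / k σ * (t ^ (1 / 2 : ℝ) * lam ^ (σ / 2)) ^ 2 := by
    have h3 : (t ^ (1 / 2 : ℝ)) ^ 2 = t := by
      rw [← Real.sqrt_eq_rpow, Real.sq_sqrt ht.le]
    have h4 : (lam ^ (σ / 2)) ^ 2 = lam ^ σ := by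
      rw [← Real.rpow_natCast, ← Real.rpow_mul hlam0.le]
      congr 1
      push_cast
      ring
    rw [mul_pow, h3, h4, hΛ]
    ring
  have hl1 := hlp (-(s₀ + s₁) / 2)
  have hl2 := hlp (σ / 2)
  have ht1 : 0 < t ^ (1 / 2 : ℝ) := Real.rpow_pos_of_pos ht _
  have hks := hk0 s₀
  have hkσ := hk0 σ
  rw [e1, e2, Real.sqrt_mul (x := k s₀ * b) (by positivity),
    Real.sqrt_mul (x := c / k σ) (by positivity), Real.sqrt_sq (by positivity), Real.sqrt_sq (by positivity)]
  have e3 : lam ^ (s - (s₀ + s₁ + σ) / 2) =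
      lam ^ s * lam ^ (-(s₀ + s₁) / 2) / lam ^ (σ / 2) := by
    rw [← Real.rpow_add hlam0, ← Real.rpow_sub hlam0]
    congr 1
    ring
  rw [e3, Real.rpow_neg ht.le]
  have : 0 < √(c / k σ) := Real.sqrt_pos.2 (by positivity)
  field_simp

end IsDispersionSymbol

/-! ### Summation of the dyadic blocks and the uniform bound. -/

theorem fourierInv_indicator_Ioc (f : ℝ → ℂ) {α β : ℝ} (hαβ : α ≤ β) (x : ℝ) :
    𝓕⁻ ((Set.Ioc α β).indicator f) x =
      ∫ η in α..β, Complex.exp (2 * Real.pi * x * η * Complex.I) * f η := by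
  rw [Real.fourierInv_eq', intervalIntegral.integral_of_le hαβ,
    ← integral_indicator measurableSet_Ioc]
  congr 1
  funext η
  by_cases h : η ∈ Set.Ioc α β
  · simp only [Set.indicator_of_mem h, smul_eq_mul, RCLike.inner_apply, conj_trivial]
    push_cast
    ring_nf
  · simp [Set.indicator_of_notMem h]

theorem exp_dispersivePhase (a : ℝ → ℝ) (t x η : ℝ) :
    Complex.exp (-(dispersivePhase a t x η * Complex.I)) =
      Complex.exp (2 * Real.pi * x * η * Complex.I) * modulation a (-t) η := by
  rw [modulation, ← Complex.exp_add, dispersivePhase]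
  congr 1
  push_cast
  ring

theorem norm_le_of_geometric {S : ℕ → ℂ} {K q : ℝ} (hK : 0 ≤ K) (hq : 0 ≤ q) (hq1 : q < 1)
    (h0 : ‖S 0‖ ≤ K) (h : ∀ n, ‖S (n + 1) - S n‖ ≤ 2 * K * q ^ n) (n : ℕ) :
    ‖S n‖ ≤ K * (1 + 2 / (1 - q)) := by
  have h1 (n : ℕ) : ‖S n‖ ≤ K + 2 * K * ∑ i ∈ Finset.range n, q ^ i := by
    induction n with
    | zero => simpa using h0
    | succ n ih =>
      have : ‖S (n + 1)‖ ≤ ‖S (n + 1) - S n‖ + ‖S n‖ := by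
        simpa using norm_add_le (S (n + 1) - S n) (S n)
      rw [Finset.sum_range_succ, mul_add]
      linarith [h n]
  refine (h1 n).trans ?_
  have h2 : ∑ i ∈ Finset.range n, q ^ i ≤ (1 - q)⁻¹ := by
    rw [← tsum_geometric_of_lt_one hq hq1]
    exact (summable_geometric_of_lt_one hq hq1).sum_le_tsum _ fun i _ ↦ by positivity
  calc K + 2 * K * ∑ i ∈ Finset.range n, q ^ i ≤ K + 2 * K * (1 - q)⁻¹ := by gcongr
    _ = _ := by rw [div_eq_mul_inv]; ring

theorem IsProfile.japaneseD_apply {a : ℝ → ℝ} {s₀ s₁ t : ℝ} {u : 𝓢'(ℝ, ℂ)} {v g : ℝ → ℂ}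
    (hp : IsProfile a s₀ s₁ t u v g) (s : ℝ) (φ : 𝓢(ℝ, ℂ)) :
    japaneseD s u φ = ∫ η, 𝓕⁻ φ η * (modulation a (-t) η * (weight s η * v η)) := by
  have h1 : japaneseD s u φ =
      𝓕 u (SchwartzMap.smulLeftCLM ℂ (fun η ↦ (weight s η : ℂ)) (𝓕⁻ φ)) := rfl
  rw [h1, hp.fourier_apply]
  congr 1
  funext η
  rw [SchwartzMap.smulLeftCLM_apply_apply (hasTemperateGrowth_weight s), smul_eq_mul]
  ring

/-- The Schwartz function absorbs the excess weight of order s - s₀, which leaves a product of two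
functions in L². -/
theorem IsDispersionSymbol.integrable_mul_profile {σ : ℝ} {a : ℝ → ℝ}
    (ha : IsDispersionSymbol σ a) {s₀ s₁ t : ℝ} {u : 𝓢'(ℝ, ℂ)} {v g : ℝ → ℂ}
    (hp : IsProfile a s₀ s₁ t u v g) (s : ℝ) (φ : 𝓢(ℝ, ℂ)) :
    Integrable fun η ↦ φ η * (modulation a (-t) η * (weight s η * v η)) := by
  have h1 := (SchwartzMap.smulLeftCLM ℂ (fun η ↦ (weight (s - s₀) η : ℂ)) φ).memLp 2 volume
  have h2 := h1.integrable_mul hp.memLp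
  have h3 : Integrable fun η ↦ modulation a (-t) η *
      ((SchwartzMap.smulLeftCLM ℂ (fun η ↦ (weight (s - s₀) η : ℂ)) φ) η *
        ((weight s₀ η : ℂ) * v η)) :=
    h2.bdd_mul (c := 1) (ha.contDiff_modulation (-t)).continuous.aestronglyMeasurable
      (.of_forall fun η ↦ (norm_modulation a (-t) η).le)
  refine h3.congr (.of_forall fun η ↦ ?_)
  have h4 : (weight s η : ℂ) = weight (s - s₀) η * weight s₀ η := by
    rw [← Complex.ofReal_mul, weight, weight, weight, ← Real.rpow_add (japanese_pos _),
      sub_add_cancel]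
  beta_reduce
  rw [SchwartzMap.smulLeftCLM_apply_apply (hasTemperateGrowth_weight (s - s₀)), smul_eq_mul, h4]
  ring

theorem tendsto_two_pow_mem_Ioc (η : ℝ) :
    ∀ᶠ n : ℕ in Filter.atTop, η ∈ Set.Ioc (-(2 : ℝ) ^ n) (2 ^ n) := by
  filter_upwards [(tendsto_pow_atTop_atTop_of_one_lt (one_lt_two (α := ℝ))).eventually_gt_atTop |η|]
    with n hn
  exact ⟨(abs_lt.1 hn).1, (abs_lt.1 hn).2.le⟩

theorem japanese_dyadic {n : ℕ} {η : ℝ} (h₁ : 2 ^ n ≤ |η|) (h₂ : |η| ≤ 2 ^ (n + 1)) :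
    2 ^ n ≤ japanese (2 * Real.pi * η) ∧ japanese (2 * Real.pi * η) ≤ 16 * 2 ^ n := by
  have hpi := Real.pi_gt_three
  have hpi2 := Real.pi_lt_d2
  have habs : |2 * Real.pi * η| = 2 * Real.pi * |η| := by
    rw [abs_mul, abs_of_pos Real.two_pi_pos]
  have h1 : (1 : ℝ) ≤ 2 ^ n := one_le_pow₀ one_le_two
  constructor
  · refine le_trans ?_ (abs_le_japanese _)
    rw [habs]
    nlinarith
  · refine (japanese_le_one_add_abs _).trans ?_
    rw [habs]
    rw [pow_succ] at h₂
    nlinarith [abs_nonneg η]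

/-- The Fourier integrals over [-2^n, 2^n] converge pointwise at a geometric rate with ratio 2^{-ε},
and their bounded limit represents ⟨D⟩^s u. -/
theorem exists_distLpNorm_top_le {σ : ℝ} {a : ℝ → ℝ} (ha : IsDispersionSymbol σ a) {s₀ s₁ : ℝ}
    (hs : s₁ ≤ s₀ + 1) {ε : ℝ} (hε : 0 < ε) : ∃ C : ℝ, 0 < C ∧ ∀ t : ℝ, 0 < t → ∀ u : 𝓢'(ℝ, ℂ),
      distLpNorm ⊤ (japaneseD ((s₀ + s₁ + σ) / 2 - ε) u)
        ≤ ENNReal.ofReal (C * t ^ (-(1 / 2) : ℝ)) * normX a s₀ s₁ t u := by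
  set s := (s₀ + s₁ + σ) / 2 - ε with hs'
  obtain ⟨C, hC, hest⟩ := ha.exists_norm_integral_le hs s
  set q : ℝ := 2 ^ (-ε) with hq
  have hq0 : 0 ≤ q := by positivity
  have hq1 : q < 1 := Real.rpow_lt_one_of_one_lt_of_neg one_lt_two (by linarith)
  have hq2 : 0 < 1 + 2 / (1 - q) := by
    have : 0 < 1 - q := by linarith
    positivity
  refine ⟨C * (1 + 2 / (1 - q)), by positivity, fun t ht u ↦ ?_⟩
  have ht1 : 0 < t ^ (-(1 / 2) : ℝ) := Real.rpow_pos_of_pos ht _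
  rcases eq_or_ne (normX a s₀ s₁ t u) ⊤ with hX | hX
  · rw [hX, ENNReal.mul_top]
    · exact le_top
    · exact (ENNReal.ofReal_pos.2 (by positivity)).ne'
  obtain ⟨v, g, hp⟩ := ha.exists_isProfile (lt_top_iff_ne_top.2 hX)
  -- A positive N above the norm replaces the norm, which may vanish, because the block estimate
  -- divides by A and B; N decreases to the norm at the end.
  have key (N : ℝ) (hN : 0 < N) (hNu : normX a s₀ s₁ t u ≤ ENNReal.ofReal N) :
      distLpNorm ⊤ (japaneseD s u) ≤
        ENNReal.ofReal (C * (1 + 2 / (1 - q)) * t ^ (-(1 / 2) : ℝ) * N) := by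
    set F : ℝ → ℝ → ℂ := fun x η ↦
      (weight s η : ℂ) * Complex.exp (-(dispersivePhase a t x η * Complex.I)) * v η with hF
    have hvc := hp.primitive.continuous
    have hFc (x : ℝ) : Continuous (F x) := by
      have h1 := (ha.contDiff_dispersivePhase t x).continuous
      have h2 := continuous_weight s
      fun_prop
    have hFi (x α β : ℝ) : IntervalIntegrable (F x) volume α β :=
      (hFc x).intervalIntegrable _ _
    set S : ℕ → ℝ → ℂ := fun n x ↦ ∫ η in (-2 ^ n)..(2 ^ n), F x η with hS
    set h : ℝ → ℂ := fun η ↦ modulation a (-t) η * (weight s η * v η) with hh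
    have hhc : Continuous h :=
      (ha.contDiff_modulation (-t)).continuous.mul ((continuous_weight s).mul hvc)
    have hneg (n : ℕ) : -(2 : ℝ) ^ n ≤ 2 ^ n := by
      have : (0 : ℝ) < 2 ^ n := by positivity
      linarith
    set hn : ℕ → ℝ → ℂ := fun n ↦ (Set.Ioc (-(2 : ℝ) ^ n) (2 ^ n)).indicator h with hhn
    have hni (n : ℕ) : Integrable (hn n) :=
      (integrable_indicator_iff measurableSet_Ioc).2
        ((intervalIntegrable_iff_integrableOn_Ioc_of_le (hneg n)).1 (hhc.intervalIntegrable _ _))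
    have hSF (n : ℕ) : S n = 𝓕⁻ (hn n) := by
      funext x
      rw [hhn, fourierInv_indicator_Ioc h (hneg n)]
      refine intervalIntegral.integral_congr fun η _ ↦ ?_
      simp only [hF, hh, exp_dispersivePhase]
      ring
    set K := C * t ^ (-(1 / 2) : ℝ) * N with hK
    have hK0 : 0 ≤ K := by positivity
    have hS0 (x : ℝ) : ‖S 0 x‖ ≤ K := by
      have := hest t u v g ht hp N 1 (-1) 1 x hN hNu le_rfl (by norm_num) (fun η hη ↦ by
        refine ⟨one_le_japanese _, (japanese_le_one_add_abs _).trans ?_⟩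
        rw [abs_mul, abs_of_pos Real.two_pi_pos]
        nlinarith [abs_le.2 hη, abs_nonneg η, Real.pi_lt_d2, Real.pi_pos])
      simp only [hS, pow_zero]
      refine this.trans_eq ?_
      rw [Real.one_rpow, hK]
      ring
    -- The factor 2 counts the blocks at positive and at negative frequencies.
    have hSn (x : ℝ) (n : ℕ) : ‖S (n + 1) x - S n x‖ ≤ 2 * K * q ^ n := by
      have hsplit : S (n + 1) x - S n x =
          (∫ η in (-2 ^ (n + 1))..(-2 ^ n), F x η) + ∫ η in (2 ^ n)..(2 ^ (n + 1)), F x η := by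
        simp only [hS]
        rw [← intervalIntegral.integral_add_adjacent_intervals (hFi x (-2 ^ (n + 1)) (-2 ^ n))
          (hFi x (-2 ^ n) (2 ^ (n + 1))), ← intervalIntegral.integral_add_adjacent_intervals
          (hFi x (-2 ^ n) (2 ^ n)) (hFi x (2 ^ n) (2 ^ (n + 1)))]
        ring
      have hl : (1 : ℝ) ≤ 2 ^ n := one_le_pow₀ one_le_two
      have hpow : ((2 : ℝ) ^ n) ^ (s - (s₀ + s₁ + σ) / 2) = q ^ n := by
        rw [hs', sub_sub_cancel_left, hq, ← Real.rpow_natCast, ← Real.rpow_mul zero_le_two,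
          ← Real.rpow_natCast, ← Real.rpow_mul zero_le_two, mul_comm]
      have e1 := hest t u v g ht hp N (2 ^ n) (-2 ^ (n + 1)) (-2 ^ n) x hN hNu hl
        (by rw [pow_succ]; linarith) (fun η hη ↦ by
          have : |η| = -η := abs_of_nonpos (by linarith [hη.2])
          exact japanese_dyadic (by linarith [hη.2]) (by linarith [hη.1]))
      have e2 := hest t u v g ht hp N (2 ^ n) (2 ^ n) (2 ^ (n + 1)) x hN hNu hl
        (by rw [pow_succ]; linarith) (fun η hη ↦ by
          have : |η| = η := abs_of_nonneg (by linarith [hη.1])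
          exact japanese_dyadic (by linarith [hη.1]) (by linarith [hη.2]))
      rw [hpow] at e1 e2
      rw [hsplit]
      refine (norm_add_le _ _).trans ((add_le_add e1 e2).trans_eq ?_)
      rw [hK]
      ring
    have hbound (x : ℝ) (n : ℕ) : ‖S n x‖ ≤ K * (1 + 2 / (1 - q)) :=
      norm_le_of_geometric (S := fun n ↦ S n x) hK0 hq0 hq1 (hS0 x) (hSn x) n
    have hlim (x : ℝ) : ∃ l, Filter.Tendsto (fun n ↦ S n x) Filter.atTop (nhds l) :=
      cauchySeq_tendsto_of_complete (cauchySeq_of_le_geometric q (2 * K) hq1 fun n ↦ by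
        rw [dist_comm, dist_eq_norm]
        exact hSn x n)
    choose L hL using hlim
    have hSc (n : ℕ) : Continuous (S n) := by
      rw [hSF n]
      exact continuous_fourierInv (hni n)
    have hLm : AEStronglyMeasurable L volume :=
      aestronglyMeasurable_of_tendsto_ae Filter.atTop (fun n ↦ (hSc n).aestronglyMeasurable)
        (.of_forall hL)
    have hLb (x : ℝ) : ‖L x‖ ≤ K * (1 + 2 / (1 - q)) :=
      le_of_tendsto (hL x).norm (.of_forall (hbound x))
    have hLp : MemLp L ⊤ volume := memLp_top_of_bound hLm _ (.of_forall hLb)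
    have hrep : (hLp.toLp L : 𝓢'(ℝ, ℂ)) = japaneseD s u := by
      ext φ
      rw [Lp.toTemperedDistribution_apply, hp.japaneseD_apply]
      have h1 : ∫ x, φ x • hLp.toLp L x = ∫ x, φ x * L x :=
        integral_congr_ae (hLp.coeFn_toLp.mono fun x hx ↦ by simp [hx])
      rw [h1]
      -- The same pairings are passed to the limit twice: in space, dominated by the uniform bound,
      -- and in frequency, dominated by the integrable product with the profile.
      have h2 : Filter.Tendsto (fun n ↦ ∫ x, φ x * S n x) Filter.atTop
          (nhds (∫ x, φ x * L x)) :=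
        tendsto_integral_of_dominated_convergence (fun x ↦ ‖φ x‖ * (K * (1 + 2 / (1 - q))))
          (fun n ↦ (φ.continuous.mul (hSc n)).aestronglyMeasurable)
          (φ.integrable.norm.mul_const _)
          (fun n ↦ .of_forall fun x ↦ by
            rw [norm_mul]
            gcongr
            exact hbound x n)
          (.of_forall fun x ↦ (hL x).const_mul _)
      have h3 : Filter.Tendsto (fun n ↦ ∫ x, φ x * S n x) Filter.atTop
          (nhds (∫ η, 𝓕⁻ φ η * h η)) := by
        simp_rw [hSF, integral_mul_fourierInv (hni _)]
        refine tendsto_integral_of_dominated_convergence (fun η ↦ ‖𝓕⁻ φ η * h η‖)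
          (fun n ↦ (𝓕⁻ φ).continuous.aestronglyMeasurable.mul (hni n).1)
          (ha.integrable_mul_profile hp s (𝓕⁻ φ)).norm
          (fun n ↦ .of_forall fun η ↦ ?_) (.of_forall fun η ↦ ?_)
        · rw [norm_mul, norm_mul]
          gcongr
          exact norm_indicator_le_norm_self _ _
        · refine tendsto_const_nhds.congr' ?_
          filter_upwards [tendsto_two_pow_mem_Ioc η] with n hη
          rw [hhn]
          simp only
          rw [Set.indicator_of_mem hη]
      exact tendsto_nhds_unique h2 h3
    rw [← hrep, distLpNorm_coe]
    have h4 : ‖hLp.toLp L‖ₑ ≤ ENNReal.ofReal (K * (1 + 2 / (1 - q))) := by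
      rw [Lp.enorm_toLp]
      exact eLpNormEssSup_le_of_ae_bound (.of_forall hLb)
    refine h4.trans_eq ?_
    congr 1
    rw [hK]
    ring
  set c := C * (1 + 2 / (1 - q)) * t ^ (-(1 / 2) : ℝ) with hc
  have hc0 : 0 < c := by positivity
  refine ENNReal.le_of_forall_pos_le_add fun e he _ ↦ ?_
  have he' : (0 : ℝ) < e := he
  refine (key ((normX a s₀ s₁ t u).toReal + e / c) (by positivity) ?_).trans_eq ?_
  · rw [ENNReal.ofReal_add ENNReal.toReal_nonneg (by positivity), ENNReal.ofReal_toReal hX]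
    exact le_self_add
  · rw [mul_add, mul_div_cancel₀ _ hc0.ne', ENNReal.ofReal_add (by positivity) he'.le,
      ENNReal.ofReal_mul hc0.le, ENNReal.ofReal_toReal hX, ENNReal.ofReal_coe_nnreal]

/-! ### Frequency localisation of the profile, Poincaré's inequality and truncated integrals. -/

theorem IsDispersionSymbol.profile_eq_zero_of_isVanishingOn {σ : ℝ} {a : ℝ → ℝ}
    (ha : IsDispersionSymbol σ a) {s₀ s₁ t : ℝ} {u : 𝓢'(ℝ, ℂ)} {v g : ℝ → ℂ}
    (hp : IsProfile a s₀ s₁ t u v g) {s : Set ℝ} (hs : IsOpen s)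
    (h : Distribution.IsVanishingOn (𝓕 u : 𝓢'(ℝ, ℂ)) s) : Set.EqOn v 0 s := by
  have hc : Continuous fun η ↦ modulation a (-t) η * v η :=
    (ha.contDiff_modulation (-t)).continuous.mul hp.primitive.continuous
  have h1 : ∀ᵐ η, η ∈ s → modulation a (-t) η * v η = 0 := by
    refine hs.ae_eq_zero_of_integral_contDiff_smul_eq_zero
      (hc.locallyIntegrable.locallyIntegrableOn s) fun φ hφ hφc hφs ↦ ?_
    have h2 : HasCompactSupport fun η ↦ (φ η : ℂ) := hφc.comp_left Complex.ofReal_zero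
    have h3 : ContDiff ℝ ∞ fun η ↦ (φ η : ℂ) := Complex.ofRealCLM.contDiff.comp hφ
    have h4 := h (h2.toSchwartzMap h3) (by
      refine (closure_mono fun η hη ↦ ?_).trans hφs
      intro h0
      exact hη (by simp [h0]))
    rw [hp.fourier_apply] at h4
    simpa [coe_toSchwartzMap] using h4
  have h2 := Measure.eqOn_open_of_ae_eq (μ := volume) (f := fun η ↦ modulation a (-t) η * v η)
    (g := fun _ ↦ 0) ((ae_restrict_iff' hs.measurableSet).2 h1) hs hc.continuousOn
    continuousOn_const
  intro η hη
  have h3 := h2 hη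
  refine (mul_eq_zero.1 h3).resolve_left ?_
  exact norm_ne_zero_iff.1 (by rw [norm_modulation]; exact one_ne_zero)

theorem IsDispersionSymbol.profile_eq_zero {σ : ℝ} {a : ℝ → ℝ}
    (ha : IsDispersionSymbol σ a) {s₀ s₁ t : ℝ} {u : 𝓢'(ℝ, ℂ)} {v g : ℝ → ℂ}
    (hp : IsProfile a s₀ s₁ t u v g) {α β : ℝ} (hu : IsLocalizedIn u α β) {η : ℝ}
    (hη : η ∉ Set.Ioo (α / (2 * Real.pi)) (β / (2 * Real.pi))) : v η = 0 := by
  have hpi := Real.two_pi_pos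
  have hz {ξ : ℝ} (hξ : ξ < α / (2 * Real.pi) ∨ β / (2 * Real.pi) < ξ) : v ξ = 0 := by
    have h1 : ξ ∉ Distribution.dsupport (𝓕 u : 𝓢'(ℝ, ℂ)) := by
      intro h2
      have h3 := hu h2
      simp only [Set.mem_ofPred_eq, Set.mem_Icc] at h3
      rw [lt_div_iff₀ hpi, div_lt_iff₀ hpi] at hξ
      rcases hξ with hξ | hξ <;> linarith
    obtain ⟨s, hs, hso, hξs⟩ := (Distribution.notMem_dsupport_iff ξ).1 h1
    exact ha.profile_eq_zero_of_isVanishingOn hp hso hs hξs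
  -- Continuity extends the vanishing to the two end points, which is what Poincaré's inequality and
  -- the integration by parts require.
  have hcl : IsClosed {ξ | v ξ = 0} := isClosed_eq hp.primitive.continuous continuous_const
  rw [Set.mem_Ioo, not_and_or, not_lt, not_lt] at hη
  rcases hη with hη | hη
  · have h1 : closure (Set.Iio (α / (2 * Real.pi))) ⊆ {ξ | v ξ = 0} :=
      hcl.closure_subset_iff.2 fun ξ hξ ↦ hz (.inl hξ)
    rw [closure_Iio] at h1
    exact h1 hη
  · have h1 : closure (Set.Ioi (β / (2 * Real.pi))) ⊆ {ξ | v ξ = 0} :=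
      hcl.closure_subset_iff.2 fun ξ hξ ↦ hz (.inr hξ)
    rw [closure_Ioi] at h1
    exact h1 hη

/-- The Poincaré inequality for a function that vanishes at an end of the interval. -/
theorem IsPrimitive.integral_norm_sq_le {v g : ℝ → ℂ} (h : IsPrimitive v g) {α β B : ℝ}
    (hαβ : α ≤ β) (hg : MemLp g 2 (volume.restrict (Set.Ioc α β))) (hB : 0 ≤ B)
    (hgB : ∫ x in α..β, ‖g x‖ ^ 2 ≤ B ^ 2) (hv : v α = 0) :
    ∫ x in α..β, ‖v x‖ ^ 2 ≤ ((β - α) * B) ^ 2 := by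
  have hpt : ∀ x ∈ Set.Icc α β, ‖v x‖ ^ 2 ≤ (β - α) * B ^ 2 := by
    intro x hx
    have h1 : ‖v x‖ ≤ √(β - α) * B := by
      have h2 := h.sub_eq α x
      rw [hv, sub_zero] at h2
      rw [h2]
      have h3 : ∫ y in α..β, ‖g y‖ ≤ √(β - α) * B := by
        have h1i : ∫ _ in α..β, ‖(1 : ℝ)‖ ^ 2 ≤ √(β - α) ^ 2 := by
          simp [Real.sq_sqrt (sub_nonneg.2 hαβ)]
        simpa using intervalIntegral_norm_mul_norm_le (f := fun _ : ℝ ↦ (1 : ℝ)) hαβ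
          (continuous_const.memLp_restrict_Ioc 2 _ _) hg (Real.sqrt_nonneg _) hB h1i hgB
      refine (intervalIntegral.norm_integral_le_integral_norm hx.1).trans (le_trans ?_ h3)
      exact intervalIntegral.integral_mono_interval le_rfl hx.1 hx.2
        (.of_forall fun y ↦ norm_nonneg _) (h.intervalIntegrable _ _).norm
    calc ‖v x‖ ^ 2 ≤ (√(β - α) * B) ^ 2 := by gcongr
      _ = _ := by rw [mul_pow, Real.sq_sqrt (sub_nonneg.2 hαβ)]
  have := intervalIntegral.integral_mono_on (μ := volume) hαβ
    ((h.continuous.norm.pow 2).intervalIntegrable _ _)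
    ((continuous_const (y := (β - α) * B ^ 2)).intervalIntegrable _ _) hpt
  refine this.trans_eq ?_
  rw [intervalIntegral.integral_const, smul_eq_mul]
  ring

section Truncation

variable {f : ℝ → ℂ} {α β B : ℝ}

theorem integrable_indicator_Ioc (hf : MemLp f 2 (volume.restrict (Set.Ioc α β))) :
    Integrable ((Set.Ioc α β).indicator f) :=
  (integrable_indicator_iff measurableSet_Ioc).2 (hf.integrable one_le_two)

theorem memLp_indicator_Ioc (hf : MemLp f 2 (volume.restrict (Set.Ioc α β))) :
    MemLp ((Set.Ioc α β).indicator f) 2 :=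
  (memLp_indicator_iff_restrict measurableSet_Ioc).2 hf

theorem eLpNorm_fourierInv_indicator_le (hαβ : α ≤ β)
    (hf : MemLp f 2 (volume.restrict (Set.Ioc α β))) (hB : 0 ≤ B)
    (h : ∫ x in α..β, ‖f x‖ ^ 2 ≤ B ^ 2) :
    eLpNorm (𝓕⁻ ((Set.Ioc α β).indicator f)) 2 ≤ ENNReal.ofReal B := by
  rw [eLpNorm_fourierInv (integrable_indicator_Ioc hf) (memLp_indicator_Ioc hf),
    eLpNorm_indicator_eq_eLpNorm_restrict measurableSet_Ioc]
  rw [intervalIntegral.integral_of_le hαβ] at h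
  exact eLpNorm_le_of_integral_norm_sq_le hf hB h

theorem norm_fourierInv_indicator_le (hαβ : α ≤ β)
    (hf : MemLp f 2 (volume.restrict (Set.Ioc α β))) (hB : 0 ≤ B)
    (h : ∫ x in α..β, ‖f x‖ ^ 2 ≤ B ^ 2) (x : ℝ) :
    ‖𝓕⁻ ((Set.Ioc α β).indicator f) x‖ ≤ √(β - α) * B := by
  rw [fourierInv_indicator_Ioc f hαβ]
  have h1i : ∫ _ in α..β, ‖(1 : ℝ)‖ ^ 2 ≤ √(β - α) ^ 2 := by
    simp [Real.sq_sqrt (sub_nonneg.2 hαβ)]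
  have h3 := intervalIntegral_norm_mul_norm_le (f := fun _ : ℝ ↦ (1 : ℝ)) hαβ
    (continuous_const.memLp_restrict_Ioc 2 _ _) hf (Real.sqrt_nonneg _) hB h1i h
  refine (intervalIntegral.norm_integral_le_integral_norm hαβ).trans (le_trans (le_of_eq ?_) h3)
  congr 1
  funext η
  rw [norm_mul, norm_one]
  congr 1
  have := Complex.norm_exp_ofReal_mul_I (2 * Real.pi * x * η)
  push_cast at this
  exact this

end Truncation

/-- Iteration gives D Σ (k+1) q^k = D/(1 - q)². The a priori bound with R only ensures that the
remainder q^n Z_n tends to zero, so R does not enter the result. -/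
theorem le_of_le_add_mul_succ {Z : ℕ → ℝ} {D R q : ℝ} (hD : 0 ≤ D) (hq : 0 ≤ q) (hq1 : q < 1)
    (h : ∀ k, Z k ≤ (k + 1) * D + q * Z (k + 1)) (hR : ∀ k, Z k ≤ (k + 1) * D + R) :
    Z 0 ≤ D / (1 - q) ^ 2 := by
  have hq2 : 0 < 1 - q := by linarith
  -- The exact solution of b_k = (k+1) + q b_{k+1} with linear growth; the excess Z_k - D b_k then
  -- obeys a homogeneous inequality.
  set b : ℕ → ℝ := fun k ↦ (k + 1) / (1 - q) + q / (1 - q) ^ 2 with hb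
  have hbk (k : ℕ) : b k = (k + 1) + q * b (k + 1) := by
    simp only [hb]
    push_cast
    field_simp
    ring
  have hb0 : b 0 = 1 / (1 - q) ^ 2 := by
    simp only [hb]
    push_cast
    field_simp
    ring
  have hbl (k : ℕ) : (k + 1 : ℝ) ≤ b k := by
    have h1 : (k + 1 : ℝ) ≤ (k + 1) / (1 - q) :=
      le_div_self (by positivity) hq2 (by linarith)
    have h2 : 0 ≤ q / (1 - q) ^ 2 := by positivity
    simp only [hb]
    linarith
  have hn (n : ℕ) : Z 0 - D * b 0 ≤ q ^ n * (Z n - D * b n) := by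
    induction n with
    | zero => simp
    | succ n ih =>
      refine ih.trans ?_
      rw [pow_succ, mul_assoc]
      gcongr
      have := h n
      rw [hbk n]
      nlinarith
  have hlim : Filter.Tendsto (fun n ↦ q ^ n * R) Filter.atTop (nhds (0 * R)) :=
    (tendsto_pow_atTop_nhds_zero_of_lt_one hq hq1).mul_const R
  rw [zero_mul] at hlim
  have h0 : Z 0 - D * b 0 ≤ 0 := by
    refine ge_of_tendsto' hlim fun n ↦ (hn n).trans ?_
    gcongr
    nlinarith [hR n, hbl n]
  rw [hb0] at h0
  rw [div_eq_mul_one_div]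
  linarith

/-! ### Velocity moments of a localised profile and decay away from the spatial interval. -/

/-- A profile on a frequency interval `[α, β]` at whose ends it vanishes; `c` and `r` are the centre
and the radius of the corresponding spatial interval, and `p` is the normalised velocity. -/
structure IsLocalProfile (a : ℝ → ℝ) (t α β c r M B : ℝ) (p : ℝ → ℝ) (v g : ℝ → ℂ) : Prop where
  primitive : IsPrimitive v g
  le : α ≤ β
  radius_pos : 0 < r
  contDiff : ContDiff ℝ 1 p
  velocity_eq : ∀ η, t * deriv a (2 * Real.pi * η) = c + r * p η
  abs_le_one : ∀ η ∈ Set.Icc α β, |p η| ≤ 1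
  abs_deriv_le : ∀ η ∈ Set.Icc α β, (β - α) * |deriv p η| ≤ M
  left_eq_zero : v α = 0
  right_eq_zero : v β = 0
  memLp : MemLp g 2 (volume.restrict (Set.Ioc α β))
  nonneg : 0 ≤ B
  integral_le : ∫ η in α..β, ‖g η‖ ^ 2 ≤ B ^ 2

/-- The profile, multiplied by a power of the normalised velocity. -/
noncomputable def velocityMoment (a : ℝ → ℝ) (t : ℝ) (p : ℝ → ℝ) (v : ℝ → ℂ) (k : ℕ) (η : ℝ) : ℂ :=
  modulation a (-t) η * ((p η : ℂ) ^ k * v η)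

/-- The derivative of `p ^ k * v`, modulated. -/
noncomputable def velocityMomentDeriv (a : ℝ → ℝ) (t : ℝ) (p : ℝ → ℝ) (v g : ℝ → ℂ) (k : ℕ)
    (η : ℝ) : ℂ :=
  modulation a (-t) η * ((p η : ℂ) ^ k * g η + k * (p η : ℂ) ^ (k - 1) * (deriv p η : ℝ) * v η)

/-- The inverse Fourier integral over the frequency interval. -/
noncomputable def truncatedInv (α β : ℝ) (f : ℝ → ℂ) : ℝ → ℂ := 𝓕⁻ ((Set.Ioc α β).indicator f)

namespace IsLocalProfile

variable {σ : ℝ} {a : ℝ → ℝ} {t α β c r M B : ℝ} {p : ℝ → ℝ} {v g : ℝ → ℂ}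

theorem continuous_velocityMoment (h : IsLocalProfile a t α β c r M B p v g)
    (ha : IsDispersionSymbol σ a) (k : ℕ) : Continuous (velocityMoment a t p v k) := by
  have h1 := (ha.contDiff_modulation (-t)).continuous
  have h2 := h.primitive.continuous
  have h3 := h.contDiff.continuous
  unfold velocityMoment
  fun_prop

theorem memLp_velocityMoment (h : IsLocalProfile a t α β c r M B p v g)
    (ha : IsDispersionSymbol σ a) (k : ℕ) :
    MemLp (velocityMoment a t p v k) 2 (volume.restrict (Set.Ioc α β)) :=
  (h.continuous_velocityMoment ha k).memLp_restrict_Ioc 2 α β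

theorem norm_velocityMoment_le (h : IsLocalProfile a t α β c r M B p v g) (k : ℕ) {η : ℝ}
    (hη : η ∈ Set.Icc α β) : ‖velocityMoment a t p v k η‖ ≤ ‖v η‖ := by
  rw [velocityMoment, norm_mul, norm_modulation, one_mul, norm_mul, norm_pow, Complex.norm_real]
  exact mul_le_of_le_one_left (norm_nonneg _)
    (pow_le_one₀ (norm_nonneg _) (h.abs_le_one η hη))

theorem nonneg_bound (h : IsLocalProfile a t α β c r M B p v g) : 0 ≤ M :=
  (mul_nonneg (sub_nonneg.2 h.le) (abs_nonneg _)).trans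
    (h.abs_deriv_le α (Set.left_mem_Icc.2 h.le))

theorem integral_velocityMoment_sq_le (h : IsLocalProfile a t α β c r M B p v g)
    (ha : IsDispersionSymbol σ a) (k : ℕ) :
    ∫ η in α..β, ‖velocityMoment a t p v k η‖ ^ 2 ≤ ((β - α) * B) ^ 2 := by
  refine le_trans (intervalIntegral.integral_mono_on h.le
    (((h.continuous_velocityMoment ha k).norm.pow 2).intervalIntegrable _ _)
    ((h.primitive.continuous.norm.pow 2).intervalIntegrable _ _) fun η hη ↦ ?_)
    (h.primitive.integral_norm_sq_le h.le h.memLp h.nonneg h.integral_le h.left_eq_zero)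
  exact pow_le_pow_left₀ (norm_nonneg _) (h.norm_velocityMoment_le k hη) 2

theorem memLp_velocityMomentDeriv (h : IsLocalProfile a t α β c r M B p v g)
    (ha : IsDispersionSymbol σ a) (k : ℕ) :
    MemLp (velocityMomentDeriv a t p v g k) 2 (volume.restrict (Set.Ioc α β)) := by
  have h1 := (ha.contDiff_modulation (-t)).continuous
  have h2 := h.primitive.continuous
  have h3 := h.contDiff.continuous
  have h4 := h.contDiff.continuous_deriv le_rfl
  have h5 : MemLp (fun η ↦ modulation a (-t) η * (p η : ℂ) ^ k * g η) 2
      (volume.restrict (Set.Ioc α β)) := by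
    refine h.memLp.of_le (AEStronglyMeasurable.fun_mul
      (by fun_prop) h.memLp.1)
      ((ae_restrict_iff' measurableSet_Ioc).2 (.of_forall fun η hη ↦ ?_))
    rw [norm_mul, norm_mul, norm_modulation, one_mul, norm_pow, Complex.norm_real]
    exact mul_le_of_le_one_left (norm_nonneg _)
      (pow_le_one₀ (norm_nonneg _) (h.abs_le_one η (Set.Ioc_subset_Icc_self hη)))
  have h6 : MemLp (fun η ↦ modulation a (-t) η *
      (k * (p η : ℂ) ^ (k - 1) * (deriv p η : ℝ) * v η)) 2 (volume.restrict (Set.Ioc α β)) :=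
    Continuous.memLp_restrict_Ioc (by fun_prop) 2 α β
  convert! h5.add h6 using 1
  funext η
  rw [velocityMomentDeriv, Pi.add_apply]
  ring

/-- Differentiating p^k costs kM/(β - α), and Poincaré's inequality returns the length β - α. Only
linear growth in k results, since |p| ≤ 1. -/
theorem integral_velocityMomentDeriv_sq_le (h : IsLocalProfile a t α β c r M B p v g)
    (ha : IsDispersionSymbol σ a) (hαβ : α < β) (k : ℕ) :
    ∫ η in α..β, ‖velocityMomentDeriv a t p v g k η‖ ^ 2 ≤ ((k + 1) * ((1 + M) * B)) ^ 2 := by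
  have hM := h.nonneg_bound
  have hB := h.nonneg
  have hd : 0 < β - α := sub_pos.2 hαβ
  have hm {f : ℝ → ℂ} (hf : MemLp f 2 (volume.restrict (Set.Ioc α β))) :
      IntervalIntegrable (fun η ↦ ‖f η‖ ^ 2) volume α β :=
    (intervalIntegrable_iff_integrableOn_Ioc_of_le h.le).2 hf.norm.integrable_sq
  have hv := h.primitive.integral_norm_sq_le h.le h.memLp h.nonneg h.integral_le h.left_eq_zero
  set m := k * M / (β - α) with hmdef
  have hm0 : 0 ≤ m := by positivity
  have hmd : m * (β - α) = k * M := div_mul_cancel₀ _ hd.ne'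
  have hvi : IntervalIntegrable (fun η ↦ ‖v η‖ ^ 2) volume α β :=
    (h.primitive.continuous.norm.pow 2).intervalIntegrable _ _
  have hpt : ∀ η ∈ Set.Icc α β, ‖velocityMomentDeriv a t p v g k η‖ ^ 2 ≤
      (1 + k * M) * ‖g η‖ ^ 2 + (1 + k * M) * (m / (β - α)) * ‖v η‖ ^ 2 := by
    intro η hη
    have hpη := h.abs_le_one η hη
    have h1 : ‖velocityMomentDeriv a t p v g k η‖ ≤ ‖g η‖ + m * ‖v η‖ := by
      rw [velocityMomentDeriv, norm_mul, norm_modulation, one_mul]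
      refine (norm_add_le _ _).trans (add_le_add ?_ ?_)
      · rw [norm_mul, norm_pow, Complex.norm_real]
        exact mul_le_of_le_one_left (norm_nonneg _) (pow_le_one₀ (norm_nonneg _) hpη)
      · rw [norm_mul, norm_mul, norm_mul, norm_pow, Complex.norm_real, Complex.norm_real,
          Complex.norm_natCast, hmdef]
        have h2 : ‖p η‖ ^ (k - 1) ≤ 1 := pow_le_one₀ (norm_nonneg _) hpη
        have h3 : ‖deriv p η‖ ≤ M / (β - α) := by
          rw [le_div_iff₀ hd, mul_comm]
          exact h.abs_deriv_le η hη
        calc (k : ℝ) * ‖p η‖ ^ (k - 1) * ‖deriv p η‖ * ‖v η‖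
            ≤ k * 1 * (M / (β - α)) * ‖v η‖ := by gcongr
          _ = _ := by ring
    have h2 : (‖g η‖ + m * ‖v η‖) ^ 2 ≤
        (1 + k * M) * ‖g η‖ ^ 2 + (1 + k * M) * (m / (β - α)) * ‖v η‖ ^ 2 := by
      rw [← hmd]
      -- Weighted Cauchy-Schwarz, with the weights for which integration gives the perfect square (1
      -- + kM)² B².
      have h3 : (1 + m * (β - α)) * ‖g η‖ ^ 2 + (1 + m * (β - α)) * (m / (β - α)) * ‖v η‖ ^ 2 -
          (‖g η‖ + m * ‖v η‖) ^ 2 = m / (β - α) * ((β - α) * ‖g η‖ - ‖v η‖) ^ 2 := by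
        field_simp
        ring
      have h4 : 0 ≤ m / (β - α) * ((β - α) * ‖g η‖ - ‖v η‖) ^ 2 := by positivity
      linarith
    exact (pow_le_pow_left₀ (norm_nonneg _) h1 2).trans h2
  have hi := intervalIntegral.integral_mono_on h.le (hm (h.memLp_velocityMomentDeriv ha k))
    (((hm h.memLp).const_mul _).add (hvi.const_mul _)) hpt
  rw [intervalIntegral.integral_add ((hm h.memLp).const_mul _) (hvi.const_mul _),
    intervalIntegral.integral_const_mul, intervalIntegral.integral_const_mul] at hi
  calc _ ≤ _ := hi
    _ ≤ (1 + k * M) * B ^ 2 + (1 + k * M) * (m / (β - α)) * ((β - α) * B) ^ 2 := by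
        gcongr
        exact h.integral_le
    _ = (1 + k * M) * B ^ 2 * (1 + m * (β - α)) := by
        field_simp
    _ = ((1 + k * M) * B) ^ 2 := by
        rw [hmd]
        ring
    _ ≤ _ := by
        rw [← mul_assoc]
        gcongr
        nlinarith [Nat.cast_nonneg (α := ℝ) k]

/-- The factor x comes from differentiating e^{2πixη}, and the derivative of e^{-ita} supplies -ta'
= -(c + rp). One integration by parts, without boundary terms, therefore trades x - c for a further
factor rp and a derivative of p^k v. -/
theorem sub_mul_truncatedInv (h : IsLocalProfile a t α β c r M B p v g)
    (ha : IsDispersionSymbol σ a) (k : ℕ) (x : ℝ) :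
    ((x - c : ℝ) : ℂ) * truncatedInv α β (velocityMoment a t p v k) x =
      r * truncatedInv α β (velocityMoment a t p v (k + 1)) x -
        (2 * Real.pi * Complex.I)⁻¹ * truncatedInv α β (velocityMomentDeriv a t p v g k) x := by
  have hE := ha.contDiff_modulation (-t)
  have hv := h.primitive.continuous
  have hpc := h.contDiff.continuous
  have hpd := h.contDiff.continuous_deriv le_rfl
  set e : ℝ → ℂ := fun η ↦ Complex.exp (2 * Real.pi * x * η * Complex.I) with he
  have hec : ContDiff ℝ 1 e := by
    have : ContDiff ℝ 1 (fun η : ℝ ↦ (η : ℂ)) := Complex.ofRealCLM.contDiff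
    exact ((contDiff_const.mul this).mul contDiff_const).cexp
  have hed (η : ℝ) : HasDerivAt e (2 * Real.pi * x * Complex.I * e η) η := by
    have h1 := (((hasDerivAt_id η).ofReal_comp.const_mul
      ((2 * Real.pi * x : ℝ) : ℂ)).mul_const Complex.I).cexp
    convert! h1 using 1
    · funext y
      simp [he]
    · simp [he]
      ring
  have hpC : ContDiff ℝ 1 fun η ↦ (p η : ℂ) ^ k :=
    (Complex.ofRealCLM.contDiff.comp h.contDiff).pow k
  have hpk (η : ℝ) : HasDerivAt (fun η ↦ (p η : ℂ) ^ k)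
      (k * (p η : ℂ) ^ (k - 1) * (deriv p η : ℝ)) η :=
    ((h.contDiff.differentiable one_ne_zero η).hasDerivAt.ofReal_comp).pow k
  set ρ : ℝ → ℂ := fun η ↦ e η * (modulation a (-t) η * (p η : ℂ) ^ k) with hρ
  have hρC : ContDiff ℝ 1 ρ := hec.mul ((hE.of_le (by simp)).mul hpC)
  have hρd (η : ℝ) : deriv ρ η = 2 * Real.pi * Complex.I *
      ((x - c : ℝ) * (e η * (modulation a (-t) η * (p η : ℂ) ^ k)) -
        r * (e η * (modulation a (-t) η * (p η : ℂ) ^ (k + 1)))) +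
      e η * (modulation a (-t) η * (k * (p η : ℂ) ^ (k - 1) * (deriv p η : ℝ))) := by
    have h0 : HasDerivAt ρ _ η := (hed η).mul ((ha.hasDerivAt_modulation (-t) η).mul (hpk η))
    rw [h0.deriv]
    have h1 : (t : ℂ) * deriv a (2 * Real.pi * η) = c + r * p η := by
      exact_mod_cast congrArg Complex.ofReal (h.velocity_eq η)
    push_cast
    linear_combination (-2 * Real.pi * Complex.I * e η * modulation a (-t) η * (p η : ℂ) ^ k) * h1
  have h1 := h.primitive.integral_mul_eq hρC α β
  rw [h.left_eq_zero, h.right_eq_zero, mul_zero, mul_zero, sub_zero, zero_sub] at h1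
  simp only [truncatedInv, fourierInv_indicator_Ioc _ h.le]
  have hEc := hE.continuous
  have hecc := hec.continuous
  have hρc := hρC.continuous
  set F : ℕ → ℝ → ℂ := fun k η ↦ e η * velocityMoment a t p v k η with hF
  have hFc (k : ℕ) : Continuous (F k) := hecc.mul (h.continuous_velocityMoment ha k)
  set Q : ℝ → ℂ := fun η ↦ e η * (modulation a (-t) η *
    (k * (p η : ℂ) ^ (k - 1) * (deriv p η : ℝ))) * v η with hQ
  have hQc : Continuous Q := by fun_prop
  have hi {f : ℝ → ℂ} (hf : Continuous f) : IntervalIntegrable f volume α β :=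
    hf.intervalIntegrable _ _
  have h2 : ∫ η in α..β, deriv ρ η * v η = 2 * Real.pi * Complex.I *
      ((x - c : ℝ) * (∫ η in α..β, F k η) - r * ∫ η in α..β, F (k + 1) η) +
        ∫ η in α..β, Q η := by
    have c1 (z : ℂ) (k : ℕ) : Continuous fun η ↦ z * F k η := continuous_const.mul (hFc k)
    have c2 (y z z' : ℂ) (k l : ℕ) : Continuous fun η ↦ y * (z * F k η - z' * F l η) :=
      continuous_const.mul ((c1 z k).sub (c1 z' l))
    rw [← intervalIntegral.integral_const_mul, ← intervalIntegral.integral_const_mul,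
      ← intervalIntegral.integral_sub (hi (c1 _ _)) (hi (c1 _ _)),
      ← intervalIntegral.integral_const_mul, ← intervalIntegral.integral_add (hi (c2 _ _ _ _ _))
        (hi hQc)]
    congr 1
    funext η
    rw [hρd]
    simp only [hF, hQ, velocityMoment]
    ring
  have h3 : ∫ η in α..β, e η * velocityMomentDeriv a t p v g k η =
      (∫ η in α..β, ρ η * g η) + ∫ η in α..β, Q η := by
    rw [← intervalIntegral.integral_add ((h.primitive.locallyIntegrable.continuous_mul
      hρc).intervalIntegrable _ _) (hi hQc)]
    congr 1
    funext η
    simp only [hρ, hQ, velocityMomentDeriv]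
    ring
  have h4 : (2 * Real.pi * Complex.I : ℂ) ≠ 0 := Complex.two_pi_I_ne_zero
  change _ * (∫ η in α..β, F k η) = r * (∫ η in α..β, F (k + 1) η) -
    _ * ∫ η in α..β, e η * velocityMomentDeriv a t p v g k η
  rw [h3, h1, h2]
  field_simp
  ring

theorem norm_sub_mul_truncatedInv_le (h : IsLocalProfile a t α β c r M B p v g)
    (ha : IsDispersionSymbol σ a) (k : ℕ) (x : ℝ) :
    ‖((x - c : ℝ) : ℂ) * truncatedInv α β (velocityMoment a t p v k) x‖ ≤
      r * ‖truncatedInv α β (velocityMoment a t p v (k + 1)) x‖ +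
        ‖truncatedInv α β (velocityMomentDeriv a t p v g k) x‖ := by
  rw [h.sub_mul_truncatedInv ha]
  refine (norm_sub_le _ _).trans (add_le_add ?_ ?_)
  · rw [norm_mul, Complex.norm_real, Real.norm_of_nonneg h.radius_pos.le]
  · rw [norm_mul]
    refine mul_le_of_le_one_left (norm_nonneg _) ?_
    rw [norm_inv, norm_mul, norm_mul, Complex.norm_I, Complex.norm_real, mul_one,
      Real.norm_of_nonneg Real.pi_pos.le, Complex.norm_ofNat]
    exact inv_le_one_of_one_le₀ (by linarith [Real.pi_gt_three])

/-- At a fixed point outside the dilate, r ≤ κ⁻¹|x - c| makes the recursion over k contractive. -/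
theorem mul_norm_truncatedInv_le (h : IsLocalProfile a t α β c r M B p v g)
    (ha : IsDispersionSymbol σ a) (hαβ : α < β) {κ x : ℝ} (hκ : 1 < κ) (hx : κ * r < |x - c|) :
    |x - c| * ‖truncatedInv α β (velocityMoment a t p v 0) x‖ ≤
      √(β - α) * ((1 + M) * B) / (1 - κ⁻¹) ^ 2 := by
  have hM := h.nonneg_bound
  have hB := h.nonneg
  have hr := h.radius_pos
  have hκ0 : 0 < κ := by linarith
  have hG (k : ℕ) : ‖truncatedInv α β (velocityMomentDeriv a t p v g k) x‖ ≤
      (k + 1) * (√(β - α) * ((1 + M) * B)) :=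
    (norm_fourierInv_indicator_le h.le (h.memLp_velocityMomentDeriv ha k) (by positivity)
      (h.integral_velocityMomentDeriv_sq_le ha hαβ k) x).trans_eq (by ring)
  have hstep (k : ℕ) := h.norm_sub_mul_truncatedInv_le ha k x
  simp only [norm_mul, Complex.norm_real, Real.norm_eq_abs] at hstep
  refine le_of_le_add_mul_succ
    (Z := fun k ↦ |x - c| * ‖truncatedInv α β (velocityMoment a t p v k) x‖)
    (R := r * (√(β - α) * ((β - α) * B))) (by positivity) (by positivity)
    (inv_lt_one_of_one_lt₀ hκ) (fun k ↦ ?_) fun k ↦ ?_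
  · have h1 : r ≤ κ⁻¹ * |x - c| := by
      rw [← div_eq_inv_mul, le_div_iff₀ hκ0]
      linarith
    have h2 : r * ‖truncatedInv α β (velocityMoment a t p v (k + 1)) x‖ ≤
        κ⁻¹ * |x - c| * ‖truncatedInv α β (velocityMoment a t p v (k + 1)) x‖ := by gcongr
    have := hstep k
    have := hG k
    linarith
  · have h1 := norm_fourierInv_indicator_le h.le (h.memLp_velocityMoment ha (k + 1))
      (mul_nonneg (sub_nonneg.2 h.le) hB) (h.integral_velocityMoment_sq_le ha (k + 1)) x
    have h2 := mul_le_mul_of_nonneg_left h1 hr.le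
    have h3 := hstep k
    have h4 := hG k
    rw [truncatedInv] at h3
    simp only [truncatedInv] at *
    linarith

theorem eLpNorm_sub_mul_truncatedInv_le (h : IsLocalProfile a t α β c r M B p v g)
    (ha : IsDispersionSymbol σ a) (hαβ : α < β) {κ : ℝ} (hκ : 1 < κ) :
    eLpNorm ({x : ℝ | κ * r < |x - c|}.indicator fun x ↦
      ((x - c : ℝ) : ℂ) * truncatedInv α β (velocityMoment a t p v 0) x) 2 ≤
      ENNReal.ofReal ((1 + M) * B / (1 - κ⁻¹) ^ 2) := by
  have hM := h.nonneg_bound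
  have hB := h.nonneg
  have hr := h.radius_pos
  have hκ0 : 0 < κ := by linarith
  set S : Set ℝ := {x : ℝ | κ * r < |x - c|} with hS
  have hSm : MeasurableSet S := measurableSet_lt (by fun_prop) (by fun_prop)
  set μ := (volume : Measure ℝ).restrict S
  set f : ℕ → ℝ → ℂ := fun k ↦ truncatedInv α β (velocityMoment a t p v k) with hf
  set G : ℕ → ℝ → ℂ := fun k ↦ truncatedInv α β (velocityMomentDeriv a t p v g k) with hGdef
  set F : ℕ → ℝ → ℂ := fun k x ↦ ((x - c : ℝ) : ℂ) * f k x with hF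
  have hmf (k : ℕ) : MemLp (f k) 2 := memLp_fourierInv
    (integrable_indicator_Ioc (h.memLp_velocityMoment ha k))
    (memLp_indicator_Ioc (h.memLp_velocityMoment ha k))
  have hmG (k : ℕ) : MemLp (G k) 2 := memLp_fourierInv
    (integrable_indicator_Ioc (h.memLp_velocityMomentDeriv ha k))
    (memLp_indicator_Ioc (h.memLp_velocityMomentDeriv ha k))
  -- The recursion identity itself shows that x - c times the moment lies in L².
  have hmF (k : ℕ) : MemLp (F k) 2 := by
    have h1 : F k = fun x ↦ r * f (k + 1) x - (2 * Real.pi * Complex.I)⁻¹ * G k x :=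
      funext fun x ↦ h.sub_mul_truncatedInv ha k x
    rw [h1]
    exact ((hmf _).const_mul _).sub ((hmG _).const_mul _)
  have hG (k : ℕ) : eLpNorm (G k) 2 μ ≤ ENNReal.ofReal ((k + 1) * ((1 + M) * B)) :=
    (eLpNorm_restrict_le _ _ _ _).trans
      (eLpNorm_fourierInv_indicator_le h.le (h.memLp_velocityMomentDeriv ha k) (by positivity)
        (h.integral_velocityMomentDeriv_sq_le ha hαβ k))
  have hfb (k : ℕ) : eLpNorm (f k) 2 μ ≤ ENNReal.ofReal ((β - α) * B) :=
    (eLpNorm_restrict_le _ _ _ _).trans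
      (eLpNorm_fourierInv_indicator_le h.le (h.memLp_velocityMoment ha k)
        (mul_nonneg (sub_nonneg.2 h.le) hB) (h.integral_velocityMoment_sq_le ha k))
  have hstep (k : ℕ) (x : ℝ) : ‖F k x‖ ≤ r * ‖f (k + 1) x‖ + ‖G k x‖ :=
    h.norm_sub_mul_truncatedInv_le ha k x
  -- Used twice: with q = κ⁻¹ and the next term of the recursion, and with q = r and the next moment
  -- for the a priori bound.
  have key {q : ℝ} (hq : 0 ≤ q) {Y : ℝ → ℂ} (hY : MemLp Y 2 μ) (k : ℕ)
      (hle : ∀ x ∈ S, ‖F k x‖ ≤ ‖G k x‖ + q * ‖Y x‖) :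
      (eLpNorm (F k) 2 μ).toReal ≤ (k + 1) * ((1 + M) * B) + q * (eLpNorm Y 2 μ).toReal := by
    have h1 : eLpNorm (F k) 2 μ ≤ eLpNorm (G k) 2 μ + ENNReal.ofReal q * eLpNorm Y 2 μ := by
      calc eLpNorm (F k) 2 μ ≤ eLpNorm ((fun x ↦ ‖G k x‖) + fun x ↦ q * ‖Y x‖) 2 μ := by
            refine eLpNorm_mono_ae_real ((ae_restrict_iff' hSm).2 (.of_forall hle))
        _ ≤ eLpNorm (fun x ↦ ‖G k x‖) 2 μ + eLpNorm (fun x ↦ q * ‖Y x‖) 2 μ :=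
            eLpNorm_add_le ((hmG k).restrict S).norm.1 (hY.norm.const_mul q).1 one_le_two
        _ ≤ _ := by
            rw [eLpNorm_norm]
            gcongr
            have := eLpNorm_const_smul_le (c := q) (f := fun x ↦ ‖Y x‖) (p := 2) (μ := μ)
            rw [eLpNorm_norm, Real.enorm_of_nonneg hq] at this
            exact this
    have h2 := h1.trans (add_le_add (hG k) le_rfl)
    have h3 := ENNReal.toReal_mono (ENNReal.add_ne_top.2
      ⟨ENNReal.ofReal_ne_top, ENNReal.mul_ne_top ENNReal.ofReal_ne_top hY.2.ne⟩) h2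
    rwa [ENNReal.toReal_add ENNReal.ofReal_ne_top (ENNReal.mul_ne_top ENNReal.ofReal_ne_top hY.2.ne),
      ENNReal.toReal_ofReal (by positivity), ENNReal.toReal_mul, ENNReal.toReal_ofReal hq] at h3
  rw [eLpNorm_indicator_eq_eLpNorm_restrict hSm,
    ← ENNReal.ofReal_toReal ((hmF 0).restrict S).2.ne]
  refine ENNReal.ofReal_le_ofReal (le_of_le_add_mul_succ
    (Z := fun k ↦ (eLpNorm (F k) 2 μ).toReal) (R := r * ((β - α) * B)) (by positivity)
    (by positivity) (inv_lt_one_of_one_lt₀ hκ) (fun k ↦ ?_) fun k ↦ ?_)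
  · refine key (by positivity) ((hmF (k + 1)).restrict S) k fun x hx ↦ ?_
    have h1 : r ≤ κ⁻¹ * |x - c| := by
      rw [← div_eq_inv_mul, le_div_iff₀ hκ0]
      have : κ * r < |x - c| := hx
      linarith
    have h2 : r * ‖f (k + 1) x‖ ≤ κ⁻¹ * |x - c| * ‖f (k + 1) x‖ := by gcongr
    have h3 : ‖F (k + 1) x‖ = |x - c| * ‖f (k + 1) x‖ := by
      rw [hF, norm_mul, Complex.norm_real, Real.norm_eq_abs]
    rw [h3]
    linarith [hstep k x]
  · refine (key hr.le ((hmf (k + 1)).restrict S) k fun x _ ↦ ?_).trans ?_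
    · linarith [hstep k x]
    · gcongr
      exact ENNReal.toReal_le_of_le_ofReal (mul_nonneg (sub_nonneg.2 h.le) hB) (hfb (k + 1))

end IsLocalProfile

/-! ### Frequency intervals and the estimates with a spatial cutoff. -/

/-- The normalised velocity is p = (ta' - c)/r. In (β - α)|p'| the time cancels, and a'' on I is
comparable to its mean over I because both are comparable to λ^σ; hence M depends only on σ, a and
K. -/
theorem IsDispersionSymbol.exists_isLocalProfile {σ : ℝ} {a : ℝ → ℝ} (ha : IsDispersionSymbol σ a)
    (s₀ s₁ : ℝ) {K : ℝ} (hK : 1 ≤ K) : ∃ M b : ℝ, 0 < M ∧ 0 < b ∧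
      ∀ (t lam α β : ℝ) (u : 𝓢'(ℝ, ℂ)) (v g : ℝ → ℂ), 0 < t → IsFrequencyInterval K lam α β →
      IsLocalizedIn u α β → normX a s₀ s₁ t u < ⊤ → IsProfile a s₀ s₁ t u v g →
      ∃ p, IsLocalProfile a t (α / (2 * Real.pi)) (β / (2 * Real.pi))
        (t * (deriv a α + deriv a β) / 2) (t * (deriv a β - deriv a α) / 2) M
        (b * lam ^ (-s₁) * (normX a s₀ s₁ t u).toReal) p v g := by
  obtain ⟨c, C, hc, hC, hac⟩ := ha.exists_bounds
  set k : ℝ → ℝ := fun q ↦ K ^ |q| with hk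
  have hk0 (q : ℝ) : 0 < k q := by positivity
  refine ⟨2 * C * k σ ^ 2 / c, 2 * Real.pi * k s₁, by have := hk0 σ; positivity,
    by have := hk0 s₁; positivity, ?_⟩
  intro t lam α β u v g ht hI hu hX hp
  have hlam0 : 0 < lam := by linarith [hI.one_le]
  have hpi := Real.two_pi_pos
  have hlt := hI.lt
  have hαβ : α / (2 * Real.pi) < β / (2 * Real.pi) := by gcongr
  have hmem {η : ℝ} (hη : η ∈ Set.Icc (α / (2 * Real.pi)) (β / (2 * Real.pi))) :
      2 * Real.pi * η ∈ Set.Icc α β := by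
    rw [Set.mem_Icc, div_le_iff₀ hpi, le_div_iff₀ hpi] at hη
    constructor <;> linarith [hη.1, hη.2]
  have hup (q : ℝ) {ξ : ℝ} (hξ : ξ ∈ Set.Icc α β) : japanese ξ ^ q ≤ k q * lam ^ q :=
    rpow_le_of_comparable hK (japanese_pos _) hlam0 (hI.bracket ξ hξ).1 (hI.bracket ξ hξ).2 q
  have hlow (q : ℝ) {ξ : ℝ} (hξ : ξ ∈ Set.Icc α β) : (k q)⁻¹ * lam ^ q ≤ japanese ξ ^ q :=
    le_rpow_of_comparable hK (japanese_pos _) hlam0 (hI.bracket ξ hξ).1 (hI.bracket ξ hξ).2 q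
  have hlp (q : ℝ) : 0 < lam ^ q := Real.rpow_pos_of_pos hlam0 q
  have hinc : c * ((k σ)⁻¹ * lam ^ σ) * (β - α) ≤ deriv a β - deriv a α := by
    refine (convex_Icc α β).mul_sub_le_image_sub_of_le_deriv
      ha.contDiff_deriv.continuous.continuousOn
      (fun ξ _ ↦ (ha.hasDerivAt_deriv ξ).differentiableAt.differentiableWithinAt)
      (fun ξ hξ ↦ ?_) α (Set.left_mem_Icc.2 hlt.le) β (Set.right_mem_Icc.2 hlt.le) hlt.le
    refine le_trans ?_ (hac ξ).1
    gcongr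
    exact hlow σ (interior_subset hξ)
  have hinc0 : 0 < deriv a β - deriv a α := sub_pos.2 (ha.strictMono_deriv hlt)
  set r := t * (deriv a β - deriv a α) / 2 with hr
  set z := t * (deriv a α + deriv a β) / 2 with hz
  have hr0 : 0 < r := by positivity
  have hpd (η : ℝ) : HasDerivAt (fun η ↦ (t * deriv a (2 * Real.pi * η) - z) / r)
      (t * (deriv (deriv a) (2 * Real.pi * η) * (2 * Real.pi)) / r) η := by
    have h0 : HasDerivAt (fun η : ℝ ↦ 2 * Real.pi * η) (2 * Real.pi) η := by
      simpa using (hasDerivAt_id η).const_mul (2 * Real.pi)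
    exact ((((ha.hasDerivAt_deriv (2 * Real.pi * η)).comp η h0).const_mul t).sub_const z).div_const r
  have hX' : normX a s₀ s₁ t u = ENNReal.ofReal (normX a s₀ s₁ t u).toReal :=
    (ENNReal.ofReal_toReal hX.ne).symm
  set N := (normX a s₀ s₁ t u).toReal with hN
  have hN0 : 0 ≤ N := ENNReal.toReal_nonneg
  have hgN : eLpNorm (fun η ↦ (weight s₁ η : ℂ) * g η) 2 ≤ ENNReal.ofReal (2 * Real.pi * N) := by
    rw [ENNReal.ofReal_mul hpi.le, ← hX']
    exact hp.eLpNorm_deriv_le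
  have hl1 : 0 < (k s₁)⁻¹ * lam ^ s₁ := mul_pos (inv_pos.2 (hk0 s₁)) (hlp s₁)
  refine ⟨fun η ↦ (t * deriv a (2 * Real.pi * η) - z) / r, ?_⟩
  constructor
  · exact hp.primitive
  · exact hαβ.le
  · exact hr0
  · exact ((contDiff_const.mul ((ha.contDiff_deriv.of_le (by simp)).comp
      (contDiff_const.mul contDiff_id))).sub contDiff_const).div_const _
  · intro η
    rw [mul_div_cancel₀ _ hr0.ne']
    ring
  · intro η hη
    have h1 := mul_le_mul_of_nonneg_left (ha.strictMono_deriv.monotone (hmem hη).1) ht.le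
    have h2 := mul_le_mul_of_nonneg_left (ha.strictMono_deriv.monotone (hmem hη).2) ht.le
    rw [abs_div, abs_of_pos hr0, div_le_one hr0, abs_le, hr, hz]
    constructor <;> linarith
  · intro η hη
    rw [(hpd η).deriv, abs_of_pos (by have := ha.deriv_deriv_pos (2 * Real.pi * η); positivity)]
    have h1 : deriv (deriv a) (2 * Real.pi * η) ≤ C * (k σ * lam ^ σ) := by
      refine (hac _).2.trans ?_
      gcongr
      exact hup σ (hmem hη)
    have hkσ := hk0 σ
    have hlσ := hlp σ
    have hd : 0 < β - α := sub_pos.2 hlt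
    calc (β / (2 * Real.pi) - α / (2 * Real.pi)) *
          (t * (deriv (deriv a) (2 * Real.pi * η) * (2 * Real.pi)) / r)
        = 2 * (β - α) * deriv (deriv a) (2 * Real.pi * η) / (deriv a β - deriv a α) := by
          rw [hr]
          field_simp
      _ ≤ 2 * (β - α) * (C * (k σ * lam ^ σ)) / (c * ((k σ)⁻¹ * lam ^ σ) * (β - α)) := by
          gcongr
      _ = _ := by
          field_simp
  · exact ha.profile_eq_zero hp hu (fun h ↦ lt_irrefl _ h.1)
  · exact ha.profile_eq_zero hp hu (fun h ↦ lt_irrefl _ h.2)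
  · exact memLp_Ioc_of_weight hp.primitive.locallyIntegrable.aestronglyMeasurable hp.memLp_deriv hl1
      fun η hη ↦ hlow s₁ (hmem hη)
  · have := hk0 s₁
    have := hlp (-s₁)
    positivity
  · refine (integral_Ioc_norm_sq_le_of_weight hαβ.le
      hp.primitive.locallyIntegrable.aestronglyMeasurable hp.memLp_deriv (by positivity) hgN hl1
      fun η hη ↦ hlow s₁ (hmem hη)).trans_eq ?_
    have := hlp s₁
    have := hk0 s₁
    rw [Real.rpow_neg hlam0.le]
    congr 1
    field_simp

theorem IsFrequencyInterval.length_le {K lam α β : ℝ} (h : IsFrequencyInterval K lam α β) :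
    β - α ≤ 2 * K * lam := by
  have h1 := (abs_le_japanese β).trans (h.bracket β (Set.right_mem_Icc.2 h.lt.le)).2
  have h2 := (abs_le_japanese α).trans (h.bracket α (Set.left_mem_Icc.2 h.lt.le)).2
  linarith [le_abs_self β, neg_abs_le α]

theorem IsProfile.toLp_fourierInv_eq {a : ℝ → ℝ} {s₀ s₁ t : ℝ} {u : 𝓢'(ℝ, ℂ)} {v g : ℝ → ℂ}
    (hp : IsProfile a s₀ s₁ t u v g) (hw : Integrable fun η ↦ modulation a (-t) η * v η)
    (hf : MemLp (𝓕⁻ fun η ↦ modulation a (-t) η * v η) 2) :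
    ((hf.toLp _ : Lp ℂ 2 (volume : Measure ℝ)) : 𝓢'(ℝ, ℂ)) = u := by
  ext φ
  have h1 : u φ = 𝓕 u (𝓕⁻ φ) := by
    rw [TemperedDistribution.fourier_apply, fourier_fourierInv_eq]
  rw [Lp.toTemperedDistribution_apply, h1, hp.fourier_apply, ← integral_mul_fourierInv hw]
  exact integral_congr_ae (hf.coeFn_toLp.mono fun x hx ↦ by simp [hx])

theorem exists_eLpNorm_cutoff_le {σ : ℝ} {a : ℝ → ℝ} (ha : IsDispersionSymbol σ a) (s₀ s₁ : ℝ)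
    {K : ℝ} (hK : 1 ≤ K) {κ : ℝ} (hκ : 1 < κ) : ∃ C : ℝ, 0 < C ∧
      ∀ t : ℝ, 0 < t → ∀ lam α β : ℝ, IsFrequencyInterval K lam α β →
      ∀ u : 𝓢'(ℝ, ℂ), IsLocalizedIn u α β → normX a s₀ s₁ t u < ⊤ →
      ∃ (f : ℝ → ℂ) (hf : MemLp f 2 volume), Continuous f ∧
        ((hf.toLp f : Lp ℂ 2 (volume : Measure ℝ)) : 𝓢'(ℝ, ℂ)) = u ∧
        ∀ x₀ ∈ spatialInterval a t α β, ∀ χ : ℝ → ℝ, IsSpatialCutoff a κ t α β χ →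
          eLpNorm (fun x : ℝ ↦ (((1 - χ x) * (x - x₀) : ℝ) : ℂ) * f x) 2 volume
            ≤ ENNReal.ofReal (C * lam ^ (-s₁)) * normX a s₀ s₁ t u ∧
          ∀ x : ℝ, ‖((1 - χ x : ℝ) : ℂ) * f x‖ₑ
            ≤ ENNReal.ofReal (C * lam ^ (-s₁ + 1 / 2) / |x - x₀|) * normX a s₀ s₁ t u := by
  obtain ⟨M, b, hM, hb, hloc⟩ := ha.exists_isLocalProfile s₀ s₁ hK
  have hκ1 : 0 < 1 - κ⁻¹ := sub_pos.2 (inv_lt_one_of_one_lt₀ hκ)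
  -- The 2 pays for replacing the centre of J̃ by an arbitrary point of J̃.
  set C₀ := 2 * ((1 + M) * b / (1 - κ⁻¹) ^ 2) with hC₀
  have hC₀0 : 0 < C₀ := by positivity
  have hK0 : 0 < K := by linarith
  refine ⟨C₀ * (1 + √(2 * K)), by positivity, fun t ht lam α β hI u hu hX ↦ ?_⟩
  have hlam0 : 0 < lam := by linarith [hI.one_le]
  obtain ⟨v, g, hp⟩ := ha.exists_isProfile hX
  obtain ⟨p, h⟩ := hloc t lam α β u v g ht hI hu hX hp
  have hpi := Real.two_pi_pos
  have hlt := hI.lt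
  have hαβ : α / (2 * Real.pi) < β / (2 * Real.pi) := by gcongr
  have hX' : normX a s₀ s₁ t u = ENNReal.ofReal (normX a s₀ s₁ t u).toReal :=
    (ENNReal.ofReal_toReal hX.ne).symm
  set N := (normX a s₀ s₁ t u).toReal with hN
  have hN0 : 0 ≤ N := ENNReal.toReal_nonneg
  set f := truncatedInv (α / (2 * Real.pi)) (β / (2 * Real.pi)) (velocityMoment a t p v 0) with hf
  -- The truncation changes nothing, as the profile vanishes off the interval; so the zeroth moment
  -- represents `u`.
  have hind : (Set.Ioc (α / (2 * Real.pi)) (β / (2 * Real.pi))).indicator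
      (velocityMoment a t p v 0) = fun η ↦ modulation a (-t) η * v η := by
    funext η
    by_cases hη : η ∈ Set.Ioc (α / (2 * Real.pi)) (β / (2 * Real.pi))
    · rw [Set.indicator_of_mem hη, velocityMoment, pow_zero, one_mul]
    · rw [Set.indicator_of_notMem hη,
        ha.profile_eq_zero hp hu fun h ↦ hη (Set.Ioo_subset_Ioc_self h), mul_zero]
  have hw₁ := integrable_indicator_Ioc (h.memLp_velocityMoment ha 0)
  have hw₂ := memLp_indicator_Ioc (h.memLp_velocityMoment ha 0)
  have hfeq : f = 𝓕⁻ fun η ↦ modulation a (-t) η * v η := by rw [hf, truncatedInv, hind]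
  have hfm : MemLp f 2 := memLp_fourierInv hw₁ hw₂
  refine ⟨f, hfm, continuous_fourierInv hw₁, ?_, fun x₀ hx₀ χ hχ ↦ ?_⟩
  · rw [hind] at hw₁
    clear_value f
    subst hfeq
    exact hp.toLp_fourierInv_eq hw₁ hfm
  set z := t * (deriv a α + deriv a β) / 2 with hz
  set r := t * (deriv a β - deriv a α) / 2 with hr
  have hr0 : 0 < r := h.radius_pos
  have hx₀r : |x₀ - z| ≤ r := by
    obtain ⟨ξ, hξ, rfl⟩ := hx₀
    have h1 := mul_le_mul_of_nonneg_left (ha.strictMono_deriv.monotone hξ.1) ht.le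
    have h2 := mul_le_mul_of_nonneg_left (ha.strictMono_deriv.monotone hξ.2) ht.le
    simp only [abs_le, hr, hz]
    constructor <;> linarith
  have hκr : r ≤ κ * r := le_mul_of_one_le_left hr0.le hκ.le
  have hχ1 {x : ℝ} (hx : ¬ κ * r < |x - z|) : χ x = 1 := by
    have h1 := abs_le.1 (not_lt.1 hx)
    exact hχ.eq_one x ⟨by rw [← hz, ← hr]; linarith [h1.1], by rw [← hz, ← hr]; linarith [h1.2]⟩
  have hχ01 (x : ℝ) : |1 - χ x| ≤ 1 := by
    have := hχ.mem_Icc x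
    rw [abs_le]
    constructor <;> linarith [this.1, this.2]
  -- Because |x₀ - z| ≤ r ≤ κr < |x - z|.
  have hdist {x : ℝ} (hx : κ * r < |x - z|) : |x - x₀| ≤ 2 * |x - z| := by
    have : |x - x₀| ≤ |x - z| + |x₀ - z| := by
      rw [abs_sub_comm x₀ z]
      exact abs_sub_le x z x₀
    linarith
  have hlp (q : ℝ) : 0 < lam ^ q := Real.rpow_pos_of_pos hlam0 q
  have hls := hlp (-s₁)
  constructor
  · have h1 := h.eLpNorm_sub_mul_truncatedInv_le ha hαβ hκ
    have h2 : eLpNorm (fun x : ℝ ↦ (((1 - χ x) * (x - x₀) : ℝ) : ℂ) * f x) 2 volume ≤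
        ENNReal.ofReal 2 * eLpNorm ({x : ℝ | κ * r < |x - z|}.indicator fun x ↦
          ((x - z : ℝ) : ℂ) * f x) 2 := by
      refine eLpNorm_le_mul_eLpNorm_of_ae_le_mul (.of_forall fun x ↦ ?_) 2
      by_cases hx : κ * r < |x - z|
      · rw [Set.indicator_of_mem (show x ∈ {x : ℝ | κ * r < |x - z|} from hx), norm_mul, norm_mul,
          Complex.norm_real, Complex.norm_real, Real.norm_eq_abs, Real.norm_eq_abs, abs_mul,
          ← mul_assoc]
        refine mul_le_mul_of_nonneg_right ?_ (norm_nonneg _)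
        calc |1 - χ x| * |x - x₀| ≤ 1 * (2 * |x - z|) := by
              gcongr
              · exact hχ01 x
              · exact hdist hx
          _ = _ := one_mul _
      · rw [hχ1 hx]
        simp
    refine h2.trans ((mul_le_mul_right h1 _).trans ?_)
    rw [hX', ← ENNReal.ofReal_mul zero_le_two, ← ENNReal.ofReal_mul (by positivity)]
    refine ENNReal.ofReal_le_ofReal ?_
    calc 2 * ((1 + M) * (b * lam ^ (-s₁) * N) / (1 - κ⁻¹) ^ 2) = C₀ * 1 * lam ^ (-s₁) * N := by
          rw [hC₀]
          ring
      _ ≤ _ := by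
          gcongr
          exact le_add_of_nonneg_right (Real.sqrt_nonneg _)
  · intro x
    -- The point x = x₀, where the right-hand side is zero by the convention for division, lies in
    -- the dilate, and there 1 - χ vanishes.
    by_cases hx : κ * r < |x - z|
    · have h1 := h.mul_norm_truncatedInv_le ha hαβ hκ hx
      have hxx₀ : 0 < |x - x₀| := by
        rw [abs_pos, sub_ne_zero]
        rintro rfl
        linarith
      rw [hX', ← ENNReal.ofReal_mul (by positivity), ← ofReal_norm]
      refine ENNReal.ofReal_le_ofReal ?_
      rw [norm_mul, Complex.norm_real, Real.norm_eq_abs, div_mul_eq_mul_div, le_div_iff₀ hxx₀]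
      have h2 : √(β / (2 * Real.pi) - α / (2 * Real.pi)) ≤ √(2 * K) * lam ^ (1 / 2 : ℝ) := by
        rw [← Real.sqrt_eq_rpow, ← Real.sqrt_mul (by positivity), ← sub_div]
        refine Real.sqrt_le_sqrt (le_trans ?_ hI.length_le)
        exact div_le_self (sub_nonneg.2 hlt.le) (by linarith [Real.pi_gt_three])
      have hl2 := hlp (1 / 2)
      calc |1 - χ x| * ‖f x‖ * |x - x₀| ≤ 1 * ‖f x‖ * (2 * |x - z|) := by
            gcongr
            · exact hχ01 x
            · exact hdist hx
        _ = 2 * (|x - z| * ‖f x‖) := by ring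
        _ ≤ 2 * (√(2 * K) * lam ^ (1 / 2 : ℝ) * ((1 + M) * (b * lam ^ (-s₁) * N)) /
            (1 - κ⁻¹) ^ 2) := by
            refine mul_le_mul_of_nonneg_left (h1.trans ?_) zero_le_two
            gcongr
        _ = C₀ * √(2 * K) * lam ^ (-s₁ + 1 / 2) * N := by
            rw [hC₀, Real.rpow_add hlam0]
            ring
        _ ≤ _ := by
            have := hlp (-s₁ + 1 / 2)
            gcongr
            linarith
    · rw [hχ1 hx]
      simp

theorem propositionp (σ s₀ s₁ : ℝ) (hs : s₁ ≤ s₀ + 1) (a : ℝ → ℝ)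
    (ha : IsDispersionSymbol σ a) :
    (0 < s₀ + s₁ + σ →
      ∀ ε : ℝ, 0 < ε → ∃ C : ℝ, 0 < C ∧ ∀ t : ℝ, 0 < t → ∀ u : 𝓢'(ℝ, ℂ),
        distLpNorm ⊤ (japaneseD ((s₀ + s₁ + σ) / 2 - ε) u)
          ≤ ENNReal.ofReal (C * t ^ (-(1 / 2) : ℝ)) * normX a s₀ s₁ t u) ∧
    (∀ K : ℝ, 1 ≤ K → ∀ κ : ℝ, 1 < κ → ∃ C : ℝ, 0 < C ∧
      ∀ t : ℝ, 0 < t → ∀ lam α β : ℝ, IsFrequencyInterval K lam α β →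
      ∀ u : 𝓢'(ℝ, ℂ), IsLocalizedIn u α β → normX a s₀ s₁ t u < ⊤ →
      ∃ (f : ℝ → ℂ) (hf : MemLp f 2 volume), Continuous f ∧
        ((hf.toLp f : Lp ℂ 2 (volume : Measure ℝ)) : 𝓢'(ℝ, ℂ)) = u ∧
        ∀ x₀ ∈ spatialInterval a t α β, ∀ χ : ℝ → ℝ, IsSpatialCutoff a κ t α β χ →
          eLpNorm (fun x : ℝ ↦ (((1 - χ x) * (x - x₀) : ℝ) : ℂ) * f x) 2 volume
            ≤ ENNReal.ofReal (C * lam ^ (-s₁)) * normX a s₀ s₁ t u ∧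
          ∀ x : ℝ, ‖((1 - χ x : ℝ) : ℂ) * f x‖ₑ
            ≤ ENNReal.ofReal (C * lam ^ (-s₁ + 1 / 2) / |x - x₀|) * normX a s₀ s₁ t u) :=
  ⟨fun _ _ hε ↦ exists_distLpNorm_top_le ha hs hε,
    fun _ hK _ hκ ↦ exists_eLpNorm_cutoff_le ha s₀ s₁ hK hκ⟩
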